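/- **Setup.** A random matrix $A\in\mathbb R^{m\times n}$, $m\le n$, is called *isotropically random orthogonal* (i.r.o.) if $AA^T=I_m$ almost surely and, for all orthogonal matrices $\Phi\in\mathbb R^{m\times m}$ and $\Theta\in\mathbb R^{n\times n}$, the matrix $\Phi A\Theta$ has the same law as $A$. For $f:\mathbb R^n\to\mathbb R$ and $x_0\in\mathbb R^n$, let $\mathcal T_f(x_0)$ be the tangent cone, i.e. the closure of the conic hull of $\{w\in\mathbb R^n : f(x_0+w)\le f(x_0)\}$. Let $$\omega_{f,x_0}=\mathbb E_h\Big[\sup_{w\in\mathcal T_f(x_0),\ \|w\|_2=1} h^Tw\Big]$$ be its Gaussian width, where $h\in\mathbb R^n$ has i.i.d. standard normal entries. The minimum conic singular value of $A$ is $$\sigma_{\min}(A;\mathcal T_f(x_0))=\inf_{x\in\mathcal T_f(x_0),\ \|x\|_2=1}\|Ax\|_2 .$$ **Theorem.** Consider a sequence of problem instances with dimensions $m\le n$, convex continuous functions $f:\mathbb R^n\to\mathbb R$, points $x_0\in\mathbb R^n$ that are not minimizers of $f$, and i.r.o. matrices $A\in\mathbb R^{m\times n}$. Write $\omega=\omega_{f,x_0}$.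 Assume the linear regime: $n\to\infty$, $m/n\to\delta$ for some $\delta\in(0,1)$, and, for some constant $\epsilon>0$, $\epsilon m<\omega^2<(1-\epsilon)m$ for all sufficiently large instances. Put $$\chi=\frac{\sqrt{n-\omega^2}}{\sqrt{n-m}}\,\frac{\sqrt m}{n}-\frac{\omega}{n},\qquad \rho=\frac{\omega}{\chi}+n-m,\qquad b=\sqrt{\frac{m+\rho^2\chi^2-2\rho\chi\omega-\rho\chi^2(n-m)}{m+\rho}} .$$ Then, for every $\zeta>0$, $$\mathbb P\big(\sigma_{\min}(A;\mathcal T_f(x_0))\ge b-\zeta\big)\longrightarrow 1 .$$ Moreover, for all sufficiently large instances, $b$ strictly exceeds the bound known for matrices with i.i.d. $\mathcal N(0,1/n)$ entries: $$b>\frac{\sqrt m-\omega}{\sqrt n}.$$ -/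

import Mathlib

open MeasureTheory ProbabilityTheory Filter Topology

noncomputable section

/-- The set of descent directions `{w | f (x₀ + w) ≤ f x₀}` of `f` at `x₀`. -/
def descentSet {n : ℕ} (f : EuclideanSpace ℝ (Fin n) → ℝ) (x₀ : EuclideanSpace ℝ (Fin n)) :
    Set (EuclideanSpace ℝ (Fin n)) :=
  {w | f (x₀ + w) ≤ f x₀}

/-- The tangent cone of `f` at `x₀`: the closure of the conic hull of the descent directions. -/
def tangentCone {n : ℕ} (f : EuclideanSpace ℝ (Fin n) → ℝ) (x₀ : EuclideanSpace ℝ (Fin n)) :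
    Set (EuclideanSpace ℝ (Fin n)) :=
  closure (PointedCone.hull ℝ (descentSet f x₀) : Set (EuclideanSpace ℝ (Fin n)))

/-- The Gaussian width `𝔼 sup {⟪h, w⟫ | w ∈ T, ‖w‖ = 1}` of a cone `T`, where `h` has i.i.d.
standard normal entries. -/
def gaussianWidth {n : ℕ} (T : Set (EuclideanSpace ℝ (Fin n))) : ℝ :=
  ∫ h, sSup ((fun w => inner ℝ h w) '' {w | w ∈ T ∧ ‖w‖ = 1})
    ∂(stdGaussian (EuclideanSpace ℝ (Fin n)))

/-- The minimum conic singular value `inf {‖A x‖ | x ∈ T, ‖x‖ = 1}` of a matrix `A` with respect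
to a cone `T` (Euclidean norms). -/
def minConicSingularValue {m n : ℕ} (A : Matrix (Fin m) (Fin n) ℝ)
    (T : Set (EuclideanSpace ℝ (Fin n))) : ℝ :=
  sInf ((fun x => ‖Matrix.toEuclideanLin A x‖) '' {x | x ∈ T ∧ ‖x‖ = 1})

/-- A random real `m × n` matrix `A` is isotropically random orthogonal: almost surely its rows
are orthonormal, and its law does not change when `A` is multiplied on the left and on the right
by deterministic orthogonal matrices. Matrices are measured through their entries. -/
structure IsIRO {Ω : Type*} [MeasurableSpace Ω] (P : Measure Ω) {m n : ℕ}
    (A : Ω → Matrix (Fin m) (Fin n) ℝ) : Prop where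
  aemeasurable_entry : ∀ i j, AEMeasurable (fun w => A w i j) P
  orthonormal_rows : ∀ᵐ w ∂P, A w * (A w).transpose = 1
  law_invariant : ∀ Φ ∈ Matrix.orthogonalGroup (Fin m) ℝ, ∀ Θ ∈ Matrix.orthogonalGroup (Fin n) ℝ,
    P.map (fun (w : Ω) (i : Fin m) (j : Fin n) => (Φ * A w * Θ) i j) =
      P.map (fun (w : Ω) (i : Fin m) (j : Fin n) => A w i j)

/-- `χ = (√(n - ω²) / √(n - m)) (√m / n) - ω / n`. -/
def chi (m n : ℕ) (ω : ℝ) : ℝ :=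
  Real.sqrt (n - ω ^ 2) / Real.sqrt ((n : ℝ) - m) * (Real.sqrt m / n) - ω / n

/-- `ρ = ω / χ + n - m`. -/
def rho (m n : ℕ) (ω : ℝ) : ℝ :=
  ω / chi m n ω + n - m

/-- `√((m + ρ²χ² - 2ρχω - ρχ²(n - m)) / (m + ρ))`. -/
def conicBound (m n : ℕ) (ω : ℝ) : ℝ :=
  Real.sqrt ((m + rho m n ω ^ 2 * chi m n ω ^ 2 - 2 * rho m n ω * chi m n ω * ω
    - rho m n ω * chi m n ω ^ 2 * ((n : ℝ) - m)) / (m + rho m n ω))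

end

/-! Write `ω = √n sin α` and `√m = √n sin β` with `0 ≤ α < β < π/2`. In these angles the expression
for `b` collapses to `sin (β - α)` (`conicBound_eq_sin`), and the strict comparison becomes `sin β -
sin α < sin (β - α)`.

For a matrix with orthonormal rows, `‖A t‖` is the sine of the angle between the unit vector `t` and
the kernel. So the conic singular value is at least `sin θ` as soon as the kernel misses the tube of
unit vectors within angle `θ` of the cone (`sin_le_minConicSingularValue`). The kernel has the least
dimension an `m × n` matrix allows, and its direction is uniformly distributed. Averaging over Haar
measure on the orthogonal group then shows that it misses a compact set at least as often as the
kernel of a Gaussian matrix does (`measure_kernelAvoiding_le`).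

For the Gaussian matrix this is Gordon's escape problem (`measureReal_exists_kernel_le`): the kernel
misses the tube with high probability when the tube's width is below `√m` by a margin that grows. An
elementary estimate bounds that width by `√n sin (α + θ)` (`inner_le_of_mem_angularTube`). With `θ =
β - α - τ` the margin is of order `√n`, because `cos β` stays away from zero when `δ < 1`.

Escape rests on two dimension-free facts about the soft minimum of `‖G x‖` over a finite net. Its
mean is bounded below by Gordon's comparison (`IsGordonPair.integral_softMin_le`), proved by
rotating one Gaussian process into the other and integrating by parts. Its variance is bounded by a
Poincaré inequality (`variance_stdGaussian_le`), so Chebyshev suffices. -/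

/-! ### Gaussian integration by parts and the Poincaré inequality. -/

section GaussianCalculus

open scoped RealInnerProductSpace

/-- Gaussian integration by parts on the real line. -/
theorem integral_mul_gaussianReal_eq_integral_deriv {h h' : ℝ → ℝ} {C : ℝ}
    (hd : ∀ x, HasDerivAt h (h' x) x) (hc' : Continuous h')
    (hb : ∀ x, |h x| ≤ C) (hb' : ∀ x, |h' x| ≤ C) :
    ∫ x, x * h x ∂(gaussianReal 0 1) = ∫ x, h' x ∂(gaussianReal 0 1) := by
  have hc : Continuous h := continuous_iff_continuousAt.2 fun x => (hd x).continuousAt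
  set φ : ℝ → ℝ := gaussianPDFReal 0 1 with hφ
  have hφd : ∀ x, HasDerivAt φ (-(x * φ x)) x := by
    intro x
    have h1 : HasDerivAt (fun x : ℝ => -(x - 0) ^ 2 / (2 * 1)) (-x) x := by
      have := (((hasDerivAt_id x).sub_const 0).pow 2).neg.div_const (2 * 1 : ℝ)
      refine this.congr_deriv ?_
      norm_num
      ring
    have h2 := (h1.exp).const_mul ((√(2 * Real.pi * 1))⁻¹)
    have h3 : φ = fun x => (√(2 * Real.pi * 1))⁻¹ * Real.exp (-(x - 0) ^ 2 / (2 * 1)) := by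
      ext y; simp [hφ, gaussianPDFReal]
    rw [h3]
    refine h2.congr_deriv ?_
    ring
  have hφc : Continuous φ := continuous_iff_continuousAt.2 fun x => (hφd x).continuousAt
  have hφi : Integrable φ := integrable_gaussianPDFReal 0 1
  have hxφi : Integrable (fun x => x * φ x) := by
    have := (integrable_mul_exp_neg_mul_sq (b := 1 / 2) (by norm_num)).const_mul
      ((√(2 * Real.pi * 1))⁻¹)
    refine this.congr (ae_of_all _ fun x => ?_)
    simp only [hφ, gaussianPDFReal, NNReal.coe_one, sub_zero]
    rw [show -(1 / 2 : ℝ) * x ^ 2 = -x ^ 2 / (2 * 1) by ring]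
    ring
  have key := integral_mul_deriv_eq_deriv_mul_of_integrable (u := h) (u' := h') (v := φ)
    (v' := fun x => -(x * φ x)) (fun x _ => hd x) (fun x _ => hφd x)
    (hxφi.neg.bdd_mul hc.aestronglyMeasurable (ae_of_all _ fun x => hb x))
    (hφi.bdd_mul hc'.aestronglyMeasurable (ae_of_all _ fun x => hb' x))
    (hφi.bdd_mul hc.aestronglyMeasurable (ae_of_all _ fun x => hb x))
  rw [integral_gaussianReal_eq_integral_smul (by norm_num),
    integral_gaussianReal_eq_integral_smul (by norm_num)]
  simp only [smul_eq_mul]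
  rw [show (∫ x, gaussianPDFReal 0 1 x * (x * h x)) = -∫ x, h x * -(x * φ x) by
    rw [← integral_neg]; congr 1; ext x; simp only [hφ]; ring, key, neg_neg]
  congr 1; ext x; ring

theorem abs_le_of_norm_fderiv_le {E : Type*} [NormedAddCommGroup E] [NormedSpace ℝ E] {f : E → ℝ} {L : ℝ} (hf : ContDiff ℝ 1 f)
    (hL : ∀ x, ‖fderiv ℝ f x‖ ≤ L) (x y : E) : |f x - f y| ≤ L * ‖x - y‖ := by
  have := Convex.norm_image_sub_le_of_norm_fderiv_le (𝕜 := ℝ) (f := f) (s := Set.univ)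
    (fun x _ => hf.differentiable one_ne_zero x) (fun x _ => hL x) convex_univ
    (Set.mem_univ y) (Set.mem_univ x)
  simpa using this

/-- Cauchy–Schwarz, obtained by expanding the integral of the squared deviation of `g` from its mean
`I / T`. -/
theorem sq_intervalIntegral_le {g : ℝ → ℝ} (hg : Continuous g) {T : ℝ} (hT : 0 < T) :
    (∫ θ in (0 : ℝ)..T, g θ) ^ 2 ≤ T * ∫ θ in (0 : ℝ)..T, g θ ^ 2 := by
  set I := ∫ θ in (0 : ℝ)..T, g θ with hI
  have h0 : 0 ≤ ∫ θ in (0 : ℝ)..T, (g θ - I / T) ^ 2 :=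
    intervalIntegral.integral_nonneg hT.le fun _ _ => sq_nonneg _
  have h1 : ∫ θ in (0 : ℝ)..T, (g θ - I / T) ^ 2 =
      (∫ θ in (0 : ℝ)..T, g θ ^ 2) - 2 * (I / T) * I + T * (I / T) ^ 2 := by
    have : ∀ θ, (g θ - I / T) ^ 2 = g θ ^ 2 - 2 * (I / T) * g θ + (I / T) ^ 2 := fun θ => by ring
    simp_rw [this]
    rw [intervalIntegral.integral_add, intervalIntegral.integral_sub,
      intervalIntegral.integral_const_mul, intervalIntegral.integral_const]
    · simp [← hI]
    all_goals exact Continuous.intervalIntegrable (by fun_prop) _ _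
  rw [h1] at h0
  have h2 : T * ((∫ θ in (0 : ℝ)..T, g θ ^ 2) - 2 * (I / T) * I + T * (I / T) ^ 2) =
      T * (∫ θ in (0 : ℝ)..T, g θ ^ 2) - I ^ 2 := by
    field_simp
    ring
  nlinarith [mul_nonneg hT.le h0]

variable {E : Type*} [NormedAddCommGroup E] [InnerProductSpace ℝ E] [FiniteDimensional ℝ E]
  [MeasurableSpace E] [BorelSpace E]

theorem map_rotation_stdGaussian (θ : ℝ) :
    ((stdGaussian E).prod (stdGaussian E)).map (ContinuousLinearMap.rotation θ) =
      (stdGaussian E).prod (stdGaussian E) :=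
  IsGaussian.map_rotation_eq_self_of_forall_strongDual_eq_zero (by simp) θ

theorem integrable_norm_stdGaussian : Integrable (fun x => ‖x‖) (stdGaussian E) :=
  IsGaussian.integrable_id.norm

theorem integrable_norm_sq_stdGaussian : Integrable (fun x => ‖x‖ ^ 2) (stdGaussian E) :=
  (IsGaussian.memLp_two_id (μ := stdGaussian E)).integrable_norm_pow (by norm_num)

theorem integral_strongDual_sq_stdGaussian (L : StrongDual ℝ E) :
    ∫ x, L x ^ 2 ∂(stdGaussian E) = ‖L‖ ^ 2 := by
  have h := variance_dual_stdGaussian L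
  rw [variance_of_integral_eq_zero (by fun_prop) (integral_strongDual_stdGaussian L)] at h
  exact h

theorem integral_norm_sq_stdGaussian :
    ∫ x, ‖x‖ ^ 2 ∂(stdGaussian E) = Module.finrank ℝ E := by
  have h : ∀ x : E, ‖x‖ ^ 2 = ∑ i, (innerSL ℝ (stdOrthonormalBasis ℝ E i) x) ^ 2 := fun x => by
    simp [(stdOrthonormalBasis ℝ E).sum_sq_inner_right]
  simp_rw [h]
  rw [integral_finsetSum]
  · simp_rw [integral_strongDual_sq_stdGaussian, innerSL_apply_norm]
    simp
  · intro i _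
    have := (IsGaussian.memLp_dual (stdGaussian E) (innerSL ℝ (stdOrthonormalBasis ℝ E i)) 2
      (by norm_num)).integrable_sq
    exact this

/-- The standard Gaussian measure is recovered when the component along a unit vector is
replaced by an independent standard normal variable. -/
theorem map_resample_stdGaussian {a : E} (ha : ‖a‖ = 1) :
    ((stdGaussian E).prod (gaussianReal 0 1)).map (fun p => p.1 - ⟪a, p.1⟫ • a + p.2 • a) =
      stdGaussian E := by
  have hm : Measurable (fun p : E × ℝ => p.1 - ⟪a, p.1⟫ • a + p.2 • a) :=
    Continuous.measurable (by fun_prop)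
  have := Measure.isProbabilityMeasure_map
    (μ := (stdGaussian E).prod (gaussianReal 0 1)) hm.aemeasurable
  apply Measure.ext_of_charFun
  ext t
  rw [charFun_apply, integral_map hm.aemeasurable (Measurable.aestronglyMeasurable (by fun_prop))]
  -- The exponent splits into the part of `t` orthogonal to `a`, seen only by `p.1`, and the part
  -- along `a`, seen only by `p.2`; Pythagoras then recombines the two characteristic functions.
  have h1 : ∀ p : E × ℝ, Complex.exp (⟪p.1 - ⟪a, p.1⟫ • a + p.2 • a, t⟫ * Complex.I) =
      Complex.exp (⟪p.1, t - ⟪a, t⟫ • a⟫ * Complex.I) *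
        Complex.exp (⟪p.2, ⟪a, t⟫⟫ * Complex.I) := by
    intro p
    rw [← Complex.exp_add]
    congr 1
    rw [← add_mul, ← Complex.ofReal_add]
    congr 2
    simp only [inner_add_left, inner_sub_left, inner_smul_left, inner_sub_right, inner_smul_right]
    simp [real_inner_comm]
    ring
  simp_rw [h1]
  rw [integral_prod_mul (f := fun x : E => Complex.exp (⟪x, t - ⟪a, t⟫ • a⟫ * Complex.I))
    (g := fun x : ℝ => Complex.exp (⟪x, ⟪a, t⟫⟫ * Complex.I)), ← charFun_apply, ← charFun_apply,
    charFun_stdGaussian, charFun_stdGaussian, charFun_gaussianReal, ← Complex.exp_add]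
  congr 1
  have h2 : ‖t - ⟪a, t⟫ • a‖ ^ 2 = ‖t‖ ^ 2 - ⟪a, t⟫ ^ 2 := by
    rw [norm_sub_sq_real, inner_smul_right, norm_smul, ha, real_inner_comm]
    simp
    ring
  have h3 : ((‖t - ⟪a, t⟫ • a‖ : ℝ) : ℂ) ^ 2 = (‖t‖ : ℂ) ^ 2 - (⟪a, t⟫ : ℂ) ^ 2 := by
    exact_mod_cast h2
  rw [h3]
  simp
  ring

/-- Gaussian integration by parts along a unit vector. -/
theorem integral_inner_mul_stdGaussian {a : E} (ha : ‖a‖ = 1) {H H' : E → ℝ} {C : ℝ}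
    (hd : ∀ x, HasDerivAt (fun s : ℝ => H (x + s • a)) (H' x) 0)
    (hc : Continuous H) (hc' : Continuous H') (hb : ∀ x, |H x| ≤ C) (hb' : ∀ x, |H' x| ≤ C) :
    Integrable H' (stdGaussian E) ∧
      ∫ x, ⟪a, x⟫ * H x ∂(stdGaussian E) = ∫ x, H' x ∂(stdGaussian E) := by
  have hm : Measurable (fun p : E × ℝ => p.1 - ⟪a, p.1⟫ • a + p.2 • a) :=
    Continuous.measurable (by fun_prop)
  have hi : Integrable (fun x => ⟪a, x⟫ * H x) (stdGaussian E) := by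
    have : Integrable (fun x : E => ⟪a, x⟫) (stdGaussian E) :=
      (innerSL ℝ a).integrable_comp IsGaussian.integrable_id
    exact this.mul_bdd hc.aestronglyMeasurable (ae_of_all _ fun x => hb x)
  have hi' : Integrable H' (stdGaussian E) :=
    (integrable_const C).mono' hc'.aestronglyMeasurable (ae_of_all _ fun x => hb' x)
  refine ⟨hi', ?_⟩
  -- Once the component along `a` is an independent normal variable, Fubini leaves a one-dimensional
  -- integration by parts in that variable.
  rw [← map_resample_stdGaussian ha] at hi hi' ⊢
  rw [integral_map hm.aemeasurable (Continuous.aestronglyMeasurable (by fun_prop)),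
    integral_map hm.aemeasurable (Continuous.aestronglyMeasurable (by fun_prop))]
  rw [integrable_map_measure (Continuous.aestronglyMeasurable (by fun_prop)) hm.aemeasurable]
    at hi hi'
  have e1 := integral_prod _ hi
  have e2 := integral_prod _ hi'
  simp only [Function.comp_def] at e1 e2
  rw [e1, e2]
  congr 1
  ext x
  have hin : ∀ g : ℝ, ⟪a, x - ⟪a, x⟫ • a + g • a⟫ = g := by
    intro g
    simp [inner_add_right, inner_sub_right, inner_smul_right, ha]
  simp_rw [hin]
  refine integral_mul_gaussianReal_eq_integral_deriv (C := C) (fun g => ?_) (by fun_prop)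
    (fun g => hb _) (fun g => hb' _)
  have h1 := hd (x - ⟪a, x⟫ • a + g • a)
  have h2 : HasDerivAt (fun s : ℝ => s - g) 1 g := (hasDerivAt_id g).sub_const g
  have h3 := HasDerivAt.comp_of_eq (h₂ := fun s : ℝ => H (x - ⟪a, x⟫ • a + g • a + s • a))
    (h := fun s => s - g) g h1 h2 (by simp)
  simp only [Function.comp_def, mul_one] at h3
  convert! h3 using 3
  module

theorem memLp_two_of_norm_fderiv_le {f : E → ℝ} {L : ℝ} (hf : ContDiff ℝ 1 f)
    (hL : ∀ x, ‖fderiv ℝ f x‖ ≤ L) : MemLp f 2 (stdGaussian E) := by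
  have ha : MemLp (fun _ : E => |f 0|) 2 (stdGaussian E) := memLp_const _
  have hn : MemLp (fun x : E => ‖x‖) 2 (stdGaussian E) :=
    (IsGaussian.memLp_two_id (μ := stdGaussian E)).norm
  have h1 : MemLp (fun x : E => |f 0| + L * ‖x‖) 2 (stdGaussian E) := ha.add (hn.const_mul L)
  refine h1.of_le hf.continuous.aestronglyMeasurable (ae_of_all _ fun x => ?_)
  have h2 := abs_le_of_norm_fderiv_le hf hL x 0
  rw [sub_zero] at h2
  have h3 := abs_sub_abs_le_abs_sub (f x) (f 0)
  rw [Real.norm_eq_abs]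
  exact le_trans (by linarith) (le_abs_self _)

/-- The Gaussian Poincaré inequality for functions with bounded gradient, with the constant
of Maurey and Pisier. -/
theorem variance_stdGaussian_le {f : E → ℝ} {L : ℝ} (hf : ContDiff ℝ 1 f)
    (hL : ∀ x, ‖fderiv ℝ f x‖ ≤ L) :
    Var[f; stdGaussian E] ≤ Real.pi ^ 2 / 8 * L ^ 2 := by
  set μ := stdGaussian E with hμ
  have hmem := memLp_two_of_norm_fderiv_le hf hL
  have hint : Integrable f μ := hmem.integrable (by norm_num)
  have hint2 : Integrable (fun x => f x ^ 2) μ := hmem.integrable_sq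
  have hL0 : 0 ≤ L := (norm_nonneg _).trans (hL 0)
  have hπ : (0 : ℝ) < Real.pi / 2 := by positivity
  obtain ⟨G, hG⟩ : ∃ G : E × E → ℝ, ∀ q, G q = fderiv ℝ f q.1 q.2 := ⟨_, fun _ => rfl⟩
  have hGc : Continuous G := by
    rw [funext hG]
    exact ((hf.continuous_fderiv one_ne_zero).comp continuous_fst).clm_apply continuous_snd
  have hGb : ∀ q, G q ^ 2 ≤ L ^ 2 * ‖q.2‖ ^ 2 := by
    intro q
    have h1 : |G q| ≤ L * ‖q.2‖ := by
      rw [hG]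
      exact ((fderiv ℝ f q.1).le_opNorm q.2).trans (by gcongr; exact hL _)
    rw [← mul_pow, ← sq_abs]
    gcongr
  have hrot : Continuous fun z : (E × E) × ℝ => ContinuousLinearMap.rotation z.2 z.1 := by
    simp only [ContinuousLinearMap.rotation_apply]
    fun_prop
  have hrotp : ∀ p : E × E, Continuous fun θ : ℝ => ContinuousLinearMap.rotation θ p := by
    intro p
    simp only [ContinuousLinearMap.rotation_apply]
    fun_prop
  -- The quarter circle from `p.1` to `p.2` has the second rotated component as its velocity;
  -- integrating along it gives `f p.2 - f p.1`.
  have hder : ∀ p θ, HasDerivAt (fun θ : ℝ => f (ContinuousLinearMap.rotation θ p).1)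
      (G (ContinuousLinearMap.rotation θ p)) θ := by
    intro p θ
    have h1 : HasDerivAt (fun θ : ℝ => (ContinuousLinearMap.rotation θ p).1)
        (ContinuousLinearMap.rotation θ p).2 θ := by
      simp only [ContinuousLinearMap.rotation_apply]
      exact ((Real.hasDerivAt_cos θ).smul_const p.1).add ((Real.hasDerivAt_sin θ).smul_const p.2)
    rw [hG]
    exact ((hf.differentiable one_ne_zero _).hasFDerivAt.comp_hasDerivAt θ h1)
  have hpt : ∀ p : E × E, (f p.2 - f p.1) ^ 2 ≤
      Real.pi / 2 * ∫ θ in (0 : ℝ)..(Real.pi / 2), G (ContinuousLinearMap.rotation θ p) ^ 2 := by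
    intro p
    have h1 := intervalIntegral.integral_eq_sub_of_hasDerivAt (a := 0) (b := Real.pi / 2)
      (fun θ _ => hder p θ) ((hGc.comp (hrotp p)).intervalIntegrable _ _)
    have h2 := sq_intervalIntegral_le (hGc.comp (hrotp p)) hπ
    simp only [Function.comp_def, h1] at h2
    simpa [ContinuousLinearMap.rotation_apply] using h2
  have hsq1 : Integrable (fun p : E × E => ‖p.1‖ ^ 2) (μ.prod μ) :=
    integrable_norm_sq_stdGaussian.comp_fst μ
  have hsq2 : Integrable (fun p : E × E => ‖p.2‖ ^ 2) (μ.prod μ) :=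
    integrable_norm_sq_stdGaussian.comp_snd μ
  have hGi : Integrable (fun z : (E × E) × ℝ => G (ContinuousLinearMap.rotation z.2 z.1) ^ 2)
      ((μ.prod μ).prod (volume.restrict (Set.Ioc 0 (Real.pi / 2)))) := by
    have hdom : Integrable (fun z : (E × E) × ℝ => 2 * L ^ 2 * (‖z.1.1‖ ^ 2 + ‖z.1.2‖ ^ 2))
        ((μ.prod μ).prod (volume.restrict (Set.Ioc 0 (Real.pi / 2)))) :=
      ((hsq1.add hsq2).const_mul (2 * L ^ 2)).comp_fst _
    have hms : Continuous fun z : (E × E) × ℝ => G (ContinuousLinearMap.rotation z.2 z.1) ^ 2 :=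
      (hGc.comp hrot).pow 2
    refine hdom.mono' hms.aestronglyMeasurable (ae_of_all _ fun z => ?_)
    rw [Real.norm_of_nonneg (sq_nonneg _)]
    refine (hGb _).trans ?_
    simp only [ContinuousLinearMap.rotation_apply]
    have h1 : ‖-Real.sin z.2 • z.1.1 + Real.cos z.2 • z.1.2‖ ≤ ‖z.1.1‖ + ‖z.1.2‖ := by
      refine (norm_add_le _ _).trans ?_
      rw [norm_smul, norm_smul, Real.norm_eq_abs, Real.norm_eq_abs, abs_neg]
      gcongr
      · exact mul_le_of_le_one_left (norm_nonneg _) (Real.abs_sin_le_one _)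
      · exact mul_le_of_le_one_left (norm_nonneg _) (Real.abs_cos_le_one _)
    have h2 : ‖-Real.sin z.2 • z.1.1 + Real.cos z.2 • z.1.2‖ ^ 2 ≤
        2 * (‖z.1.1‖ ^ 2 + ‖z.1.2‖ ^ 2) := by
      refine (pow_le_pow_left₀ (norm_nonneg _) h1 2).trans ?_
      nlinarith [sq_nonneg (‖z.1.1‖ - ‖z.1.2‖)]
    nlinarith [sq_nonneg L]
  -- Position and velocity are independent, so integrating out the velocity turns `G²` into the
  -- squared gradient norm. Rotation invariance makes this one bound serve every angle.
  have hG2 : ∫ q, G q ^ 2 ∂(μ.prod μ) ≤ L ^ 2 := by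
    have hGi2 : Integrable (fun q => G q ^ 2) (μ.prod μ) := by
      have hms : Continuous fun q => G q ^ 2 := hGc.pow 2
      refine (hsq2.const_mul (L ^ 2)).mono' hms.aestronglyMeasurable (ae_of_all _ fun q => ?_)
      rw [Real.norm_of_nonneg (sq_nonneg _)]
      exact hGb q
    rw [integral_prod _ hGi2]
    have h1 : ∀ x, ∫ y, G (x, y) ^ 2 ∂μ = ‖fderiv ℝ f x‖ ^ 2 := fun x => by
      simp_rw [hG]
      exact integral_strongDual_sq_stdGaussian (fderiv ℝ f x)
    simp_rw [h1]
    have h2 : ∀ x, ‖‖fderiv ℝ f x‖ ^ 2‖ ≤ L ^ 2 := fun x => by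
      rw [Real.norm_of_nonneg (sq_nonneg _)]
      gcongr
      exact hL x
    have h3 := norm_integral_le_of_norm_le_const (μ := μ) (ae_of_all _ h2)
    simp only [probReal_univ, mul_one] at h3
    exact (le_abs_self _).trans h3
  have hdiff : Integrable (fun p : E × E => (f p.2 - f p.1) ^ 2) (μ.prod μ) :=
    ((hmem.comp_snd μ).sub (hmem.comp_fst μ)).integrable_sq
  have hle : ∫ p, (f p.2 - f p.1) ^ 2 ∂(μ.prod μ) ≤ (Real.pi / 2) ^ 2 * L ^ 2 := by
    calc ∫ p, (f p.2 - f p.1) ^ 2 ∂(μ.prod μ)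
        ≤ ∫ p, (Real.pi / 2 * ∫ θ in Set.Ioc 0 (Real.pi / 2),
            G (ContinuousLinearMap.rotation θ p) ^ 2) ∂(μ.prod μ) := by
          have hGi' := hGi.integral_prod_left.const_mul (Real.pi / 2)
          refine integral_mono hdiff hGi' fun p => ?_
          have := hpt p
          rwa [intervalIntegral.integral_of_le hπ.le] at this
      _ = Real.pi / 2 * ∫ θ in Set.Ioc 0 (Real.pi / 2), (∫ p,
            G (ContinuousLinearMap.rotation θ p) ^ 2 ∂(μ.prod μ)) := by
          rw [integral_const_mul, integral_integral_swap hGi]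
      _ = Real.pi / 2 * ∫ θ in Set.Ioc 0 (Real.pi / 2), (∫ q, G q ^ 2 ∂(μ.prod μ)) := by
          congr 2
          ext θ
          conv_rhs => rw [hμ, ← map_rotation_stdGaussian (E := E) θ]
          rw [integral_map (by fun_prop) (by fun_prop)]
      _ ≤ (Real.pi / 2) ^ 2 * L ^ 2 := by
          rw [integral_const]
          simp only [measureReal_restrict_apply_univ, Real.volume_real_Ioc_of_le hπ.le, sub_zero,
            smul_eq_mul]
          rw [pow_two (Real.pi / 2), mul_assoc]
          gcongr
  -- Two independent copies double the variance, which turns `(π/2)²` into `π²/8`.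
  have hvar : ∫ p, (f p.2 - f p.1) ^ 2 ∂(μ.prod μ) = 2 * Var[f; μ] := by
    have h1 : ∀ p : E × E, (f p.2 - f p.1) ^ 2 = f p.2 ^ 2 - 2 * (f p.1 * f p.2) + f p.1 ^ 2 :=
      fun p => by ring
    simp_rw [h1]
    rw [integral_add, integral_sub, integral_const_mul, integral_prod_mul,
      integral_fun_snd (fun x => f x ^ 2), integral_fun_fst (fun x => f x ^ 2),
      variance_eq_sub hmem]
    · simp
      ring
    · exact hint2.comp_snd μ
    · exact (hint.mul_prod hint).const_mul 2
    · exact (hint2.comp_snd μ).sub ((hint.mul_prod hint).const_mul 2)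
    · exact hint2.comp_fst μ
  rw [hvar] at hle
  linarith

end GaussianCalculus

/-! ### The soft minimum and its Gibbs weights. -/

section SoftMin

variable {ι : Type*} [Fintype ι]

/-- The smooth approximation `-β⁻¹ log ∑ exp (-β f)` of the minimum of a finite family. -/
noncomputable def softMin (β : ℝ) (f : ι → ℝ) : ℝ :=
  -β⁻¹ * Real.log (∑ x, Real.exp (-β * f x))

/-- The Gibbs weights, which are the partial derivatives of `softMin`. -/
noncomputable def gibbsWeight (β : ℝ) (f : ι → ℝ) (x : ι) : ℝ :=
  Real.exp (-β * f x) / ∑ y, Real.exp (-β * f y)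

theorem sum_exp_pos [Nonempty ι] (β : ℝ) (f : ι → ℝ) : 0 < ∑ x, Real.exp (-β * f x) :=
  Finset.sum_pos (fun _ _ => Real.exp_pos _) Finset.univ_nonempty

theorem gibbsWeight_nonneg (β : ℝ) (f : ι → ℝ) (x : ι) : 0 ≤ gibbsWeight β f x :=
  div_nonneg (Real.exp_pos _).le (Finset.sum_nonneg fun _ _ => (Real.exp_pos _).le)

theorem sum_gibbsWeight [Nonempty ι] (β : ℝ) (f : ι → ℝ) : ∑ x, gibbsWeight β f x = 1 := by
  simp only [gibbsWeight, ← Finset.sum_div]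
  exact div_self (sum_exp_pos β f).ne'

theorem gibbsWeight_le_one [Nonempty ι] (β : ℝ) (f : ι → ℝ) (x : ι) : gibbsWeight β f x ≤ 1 := by
  rw [← sum_gibbsWeight β f]
  exact Finset.single_le_sum (fun y _ => gibbsWeight_nonneg β f y) (Finset.mem_univ x)

theorem abs_gibbsWeight_le_one [Nonempty ι] (β : ℝ) (f : ι → ℝ) (x : ι) :
    |gibbsWeight β f x| ≤ 1 := by
  rw [abs_of_nonneg (gibbsWeight_nonneg β f x)]
  exact gibbsWeight_le_one β f x

theorem softMin_le {β : ℝ} (hβ : 0 < β) (f : ι → ℝ) (x : ι) : softMin β f ≤ f x := by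
  have h1 : Real.exp (-β * f x) ≤ ∑ y, Real.exp (-β * f y) :=
    Finset.single_le_sum (f := fun y => Real.exp (-β * f y)) (fun _ _ => (Real.exp_pos _).le)
      (Finset.mem_univ x)
  have h2 : -β * f x ≤ Real.log (∑ y, Real.exp (-β * f y)) := by
    rw [← Real.log_exp (-β * f x)]
    exact Real.log_le_log (Real.exp_pos _) h1
  have h3 := mul_le_mul_of_nonneg_left h2 (inv_nonneg.2 hβ.le)
  have h4 : β⁻¹ * (-β * f x) = -f x := by field_simp
  rw [softMin]
  linarith

/-- At most `card ι` terms, each at most `exp (-β c)`: this is the price of smoothing. It is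
logarithmic in the size of the family and is made harmless by a large `β`. -/
theorem le_softMin [Nonempty ι] {β c : ℝ} (hβ : 0 < β) {f : ι → ℝ} (h : ∀ x, c ≤ f x) :
    c - β⁻¹ * Real.log (Fintype.card ι) ≤ softMin β f := by
  have h1 : ∑ y, Real.exp (-β * f y) ≤ Fintype.card ι * Real.exp (-β * c) := by
    rw [← nsmul_eq_mul, ← Finset.card_univ]
    refine Finset.sum_le_card_nsmul _ _ _ fun y _ => Real.exp_le_exp.2 ?_
    nlinarith [h y]
  have h2 := Real.log_le_log (sum_exp_pos β f) h1
  rw [Real.log_mul (by simp) (Real.exp_pos _).ne', Real.log_exp] at h2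
  have h3 := mul_le_mul_of_nonneg_left h2 (inv_nonneg.2 hβ.le)
  have h4 : β⁻¹ * (Real.log (Fintype.card ι) + -β * c) =
      β⁻¹ * Real.log (Fintype.card ι) - c := by field_simp; ring
  rw [softMin]
  linarith

theorem abs_softMin_le [Nonempty ι] {β : ℝ} (hβ : 0 < β) (f : ι → ℝ) :
    |softMin β f| ≤ ∑ x, |f x| + β⁻¹ * Real.log (Fintype.card ι) := by
  have hs : ∀ x, |f x| ≤ ∑ y, |f y| := fun x =>
    Finset.single_le_sum (f := fun y => |f y|) (fun _ _ => abs_nonneg _) (Finset.mem_univ x)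
  have hl : 0 ≤ β⁻¹ * Real.log (Fintype.card ι) :=
    mul_nonneg (inv_nonneg.2 hβ.le) (Real.log_natCast_nonneg _)
  rw [abs_le]
  constructor
  · have := le_softMin hβ (f := f) (c := -∑ y, |f y|) fun x =>
      (neg_le_neg (hs x)).trans (neg_abs_le _)
    linarith
  · obtain ⟨x⟩ := ‹Nonempty ι›
    have := softMin_le hβ f x
    linarith [hs x, le_abs_self (f x)]

theorem hasDerivAt_sum_exp {β t : ℝ} {f : ℝ → ι → ℝ} {f' : ι → ℝ}
    (hf : ∀ x, HasDerivAt (fun s => f s x) (f' x) t) :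
    HasDerivAt (fun s => ∑ x, Real.exp (-β * f s x))
      (∑ x, Real.exp (-β * f t x) * (-β * f' x)) t :=
  HasDerivAt.fun_sum fun x _ => ((hf x).const_mul (-β)).exp

theorem hasDerivAt_softMin [Nonempty ι] {β t : ℝ} (hβ : 0 < β) {f : ℝ → ι → ℝ} {f' : ι → ℝ}
    (hf : ∀ x, HasDerivAt (fun s => f s x) (f' x) t) :
    HasDerivAt (fun s => softMin β (f s)) (∑ x, gibbsWeight β (f t) x * f' x) t := by
  have h := ((hasDerivAt_sum_exp (β := β) hf).log (sum_exp_pos β (f t)).ne').const_mul (-β⁻¹)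
  refine h.congr_deriv ?_
  rw [Finset.sum_div, Finset.mul_sum]
  refine Finset.sum_congr rfl fun x _ => ?_
  rw [gibbsWeight]
  field_simp

/-- Logarithmic differentiation: the relative change of a weight is `-β` times the deviation of `f'
x` from its Gibbs mean. In the applications below `f' x = 0` at the differentiated index, and only
the mean survives, with sign `+β`. -/
theorem hasDerivAt_gibbsWeight [Nonempty ι] {β t : ℝ} {f : ℝ → ι → ℝ} {f' : ι → ℝ}
    (hf : ∀ x, HasDerivAt (fun s => f s x) (f' x) t) (x : ι) :
    HasDerivAt (fun s => gibbsWeight β (f s) x)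
      (-β * gibbsWeight β (f t) x * (f' x - ∑ y, gibbsWeight β (f t) y * f' y)) t := by
  have h := ((hf x).const_mul (-β)).exp.div (hasDerivAt_sum_exp (β := β) hf)
    (sum_exp_pos β (f t)).ne'
  refine h.congr_deriv ?_
  have hz := (sum_exp_pos β (f t)).ne'
  have h1 : ∑ y, Real.exp (-β * f t y) * (-β * f' y) =
      -β * ((∑ y, Real.exp (-β * f t y)) * ∑ y, gibbsWeight β (f t) y * f' y) := by
    rw [Finset.mul_sum, Finset.mul_sum]
    refine Finset.sum_congr rfl fun y _ => ?_
    rw [gibbsWeight]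
    field_simp
  rw [h1, gibbsWeight]
  field_simp
  ring

theorem continuous_softMin [Nonempty ι] {X : Type*} [TopologicalSpace X] {β : ℝ} {f : X → ι → ℝ}
    (hf : ∀ x, Continuous fun s => f s x) : Continuous fun s => softMin β (f s) := by
  unfold softMin
  exact continuous_const.mul
    (Continuous.log (by fun_prop) fun s => (sum_exp_pos β (f s)).ne')

theorem continuous_gibbsWeight [Nonempty ι] {X : Type*} [TopologicalSpace X] {β : ℝ}
    {f : X → ι → ℝ} (hf : ∀ x, Continuous fun s => f s x) (x : ι) :
    Continuous fun s => gibbsWeight β (f s) x := by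
  unfold gibbsWeight
  exact Continuous.div (by fun_prop) (by fun_prop) fun s => (sum_exp_pos β (f s)).ne'

end SoftMin

/-! ### A smooth substitute for the Euclidean norm. -/

section SmoothNorm

variable {I : Type*} [Fintype I]

/-- The smooth approximation `√(1 + ∑ vᵢ²)` of the Euclidean norm. -/
noncomputable def smoothNorm (v : I → ℝ) : ℝ := √(1 + ∑ i, v i ^ 2)

theorem smoothNorm_pos (v : I → ℝ) : 0 < smoothNorm v := Real.sqrt_pos.2 (by positivity)

theorem smoothNorm_sq (v : I → ℝ) : smoothNorm v ^ 2 = 1 + ∑ i, v i ^ 2 :=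
  Real.sq_sqrt (by positivity)

theorem hasDerivAt_smoothNorm {v : ℝ → I → ℝ} {v' : I → ℝ} {t : ℝ}
    (hv : ∀ i, HasDerivAt (fun s => v s i) (v' i) t) :
    HasDerivAt (fun s => smoothNorm (v s)) (∑ i, v t i / smoothNorm (v t) * v' i) t := by
  have h1 : HasDerivAt (fun s => 1 + ∑ i, v s i ^ 2) (∑ i, 2 * v t i * v' i) t := by
    refine HasDerivAt.const_add _ (HasDerivAt.fun_sum fun i _ => ?_)
    refine ((hv i).fun_pow 2).congr_deriv ?_
    simp
  refine (h1.sqrt (by positivity)).congr_deriv ?_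
  rw [Finset.sum_div]
  refine Finset.sum_congr rfl fun i _ => ?_
  rw [show √(1 + ∑ i, v t i ^ 2) = smoothNorm (v t) from rfl]
  have := (smoothNorm_pos (v t)).ne'
  field_simp

theorem continuous_smoothNorm {X : Type*} [TopologicalSpace X] {v : X → I → ℝ}
    (hv : ∀ i, Continuous fun s => v s i) : Continuous fun s => smoothNorm (v s) := by
  unfold smoothNorm
  fun_prop

theorem sum_sq_div_smoothNorm_le (v : I → ℝ) : ∑ i, (v i / smoothNorm v) ^ 2 ≤ 1 := by
  simp_rw [div_pow]
  rw [← Finset.sum_div, div_le_one (pow_pos (smoothNorm_pos v) 2), smoothNorm_sq]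
  linarith

theorem abs_div_smoothNorm_le (v : I → ℝ) (i : I) : |v i / smoothNorm v| ≤ 1 := by
  rw [← sq_le_one_iff_abs_le_one]
  exact (Finset.single_le_sum (f := fun i => (v i / smoothNorm v) ^ 2)
    (fun _ _ => sq_nonneg _) (Finset.mem_univ i)).trans (sum_sq_div_smoothNorm_le v)

/-- The normalized vectors lie in the unit ball. This supplies the nonnegative factor `1 - ∑ i, n x
i * n y i` on which the sign in Gordon's comparison depends. -/
theorem sum_mul_div_smoothNorm_le (v w : I → ℝ) :
    ∑ i, v i / smoothNorm v * (w i / smoothNorm w) ≤ 1 := by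
  have h := Finset.sum_le_sum fun i (_ : i ∈ Finset.univ) =>
    two_mul_le_add_sq (v i / smoothNorm v) (w i / smoothNorm w)
  rw [Finset.sum_add_distrib] at h
  simp_rw [mul_assoc] at h
  rw [← Finset.mul_sum] at h
  linarith [sum_sq_div_smoothNorm_le v, sum_sq_div_smoothNorm_le w]

theorem smoothNorm_le (v : I → ℝ) : smoothNorm v ≤ 1 + ∑ i, |v i| := by
  refine Real.sqrt_le_iff.2 ⟨by positivity, ?_⟩
  have := Finset.sum_sq_le_sq_sum_of_nonneg (s := Finset.univ) (f := fun i => |v i|)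
    fun _ _ => abs_nonneg _
  simp only [sq_abs] at this
  nlinarith [Finset.sum_nonneg fun i (_ : i ∈ Finset.univ) => abs_nonneg (v i)]

end SmoothNorm

/-! ### Gordon's comparison by rotating one Gaussian process into the other. -/

section GordonComparison

open scoped RealInnerProductSpace

variable {E : Type*} [NormedAddCommGroup E] [InnerProductSpace ℝ E]
  {ι I : Type*}

/-- The vectors `A x i`, `a x` and `B x i`, `b x` represent, as linear functionals of a standard
Gaussian vector, the two Gaussian processes of Gordon's comparison theorem: a Gaussian matrix
applied to unit vectors with Gram matrix `K` and an independent scalar, and a Gaussian vector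
and an independent scalar process with covariance `K`. -/
structure IsGordonPair [DecidableEq I] (K : ι → ι → ℝ) (A B : ι → I → E) (a b : ι → E) : Prop where
  diag : ∀ x, K x x = 1
  le_one : ∀ x y, K x y ≤ 1
  inner_A_A : ∀ x y i j, ⟪A x i, A y j⟫ = if i = j then K x y else 0
  inner_B_B : ∀ x y i j, ⟪B x i, B y j⟫ = if i = j then 1 else 0
  inner_A_B : ∀ x y i j, ⟪A x i, B y j⟫ = 0
  inner_a_a : ∀ x y, ⟪a x, a y⟫ = 1
  inner_b_b : ∀ x y, ⟪b x, b y⟫ = K x y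
  inner_a_b : ∀ x y, ⟪a x, b y⟫ = 0
  inner_A_a : ∀ x y i, ⟪A x i, a y⟫ = 0
  inner_A_b : ∀ x y i, ⟪A x i, b y⟫ = 0
  inner_B_a : ∀ x y i, ⟪B x i, a y⟫ = 0
  inner_B_b : ∀ x y i, ⟪B x i, b y⟫ = 0

/-- Rotation of the pair `(a, b)` by the angle `θ`, first component. -/
noncomputable def rotL (θ : ℝ) (a b : E) : E := Real.cos θ • a + Real.sin θ • b

/-- Rotation of the pair `(a, b)` by the angle `θ`, second component. -/
noncomputable def rotR (θ : ℝ) (a b : E) : E := -Real.sin θ • a + Real.cos θ • b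

theorem hasDerivAt_rotL (θ : ℝ) (a b ξ : E) :
    HasDerivAt (fun t => ⟪rotL t a b, ξ⟫) ⟪rotR θ a b, ξ⟫ θ := by
  simp only [rotL, rotR, inner_add_left, inner_smul_left, neg_smul, inner_neg_left]
  simpa using! ((Real.hasDerivAt_cos θ).mul_const ⟪a, ξ⟫).add
    ((Real.hasDerivAt_sin θ).mul_const ⟪b, ξ⟫)

namespace IsGordonPair

variable [DecidableEq I] {K : ι → ι → ℝ} {A B : ι → I → E} {a b : ι → E}

/-- Covariance of the velocity at `x` with the process at `y`. It vanishes for `x = y`, and it is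
exactly opposite to the covariance of the scalar parts; these two features drive the comparison. -/
theorem inner_rotR_rotL_same (hp : IsGordonPair K A B a b) (θ : ℝ) (x y : ι) (i j : I) :
    ⟪rotR θ (A x i) (B x i), rotL θ (A y j) (B y j)⟫ =
      if i = j then Real.sin θ * Real.cos θ * (1 - K x y) else 0 := by
  simp only [rotL, rotR, inner_add_left, inner_add_right, inner_smul_left, inner_smul_right,
    hp.inner_A_A, hp.inner_B_B, hp.inner_A_B, real_inner_comm (A _ _) (B _ _)]
  split_ifs
  · simp
    ring
  · simp

theorem inner_rotR_rotL_scalar (hp : IsGordonPair K A B a b) (θ : ℝ) (x y : ι) :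
    ⟪rotR θ (a x) (b x), rotL θ (a y) (b y)⟫ = -(Real.sin θ * Real.cos θ * (1 - K x y)) := by
  simp only [rotL, rotR, inner_add_left, inner_add_right, inner_smul_left, inner_smul_right,
    hp.inner_a_a, hp.inner_b_b, hp.inner_a_b, real_inner_comm (a _) (b _)]
  simp
  ring

theorem inner_rotR_rotL_cross (hp : IsGordonPair K A B a b) (θ : ℝ) (x y : ι) (i : I) :
    ⟪rotR θ (A x i) (B x i), rotL θ (a y) (b y)⟫ = 0 := by
  simp [rotL, rotR, inner_add_left, inner_add_right, inner_smul_left, inner_smul_right,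
    hp.inner_A_a, hp.inner_A_b, hp.inner_B_a, hp.inner_B_b]

theorem inner_rotR_rotL_cross' (hp : IsGordonPair K A B a b) (θ : ℝ) (x y : ι) (i : I) :
    ⟪rotR θ (a y) (b y), rotL θ (A x i) (B x i)⟫ = 0 := by
  rw [real_inner_comm]
  simp [rotL, rotR, inner_add_left, inner_add_right, inner_smul_left, inner_smul_right,
    hp.inner_A_a, hp.inner_A_b, hp.inner_B_a, hp.inner_B_b]

theorem norm_rotR_vector (hp : IsGordonPair K A B a b) (θ : ℝ) (x : ι) (i : I) :
    ‖rotR θ (A x i) (B x i)‖ = 1 := by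
  rw [← sq_eq_sq₀ (norm_nonneg _) zero_le_one, ← real_inner_self_eq_norm_sq]
  simp only [rotR, inner_add_left, inner_add_right, inner_smul_left, inner_smul_right,
    hp.inner_A_A, hp.inner_B_B, hp.inner_A_B, real_inner_comm (A _ _) (B _ _), hp.diag]
  simp
  nlinarith [Real.sin_sq_add_cos_sq θ]

theorem norm_rotR_scalar (hp : IsGordonPair K A B a b) (θ : ℝ) (x : ι) :
    ‖rotR θ (a x) (b x)‖ = 1 := by
  rw [← sq_eq_sq₀ (norm_nonneg _) zero_le_one, ← real_inner_self_eq_norm_sq]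
  simp only [rotR, inner_add_left, inner_add_right, inner_smul_left, inner_smul_right,
    hp.inner_a_a, hp.inner_b_b, hp.inner_a_b, real_inner_comm (a _) (b _), hp.diag]
  simp
  nlinarith [Real.sin_sq_add_cos_sq θ]

end IsGordonPair

variable [Fintype I]

/-- The field `√(1 + ∑ i, ⟪A x i, ξ⟫²) + ⟪a x, ξ⟫` associated with a Gordon process. -/
noncomputable def gordonField (A : ι → I → E) (a : ι → E) (ξ : E) (x : ι) : ℝ :=
  smoothNorm (fun i => ⟪A x i, ξ⟫) + ⟪a x, ξ⟫

/-- The direction of `(⟪A x i, ξ⟫)ᵢ`, up to smoothing. -/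
noncomputable def gordonDir (A : ι → I → E) (ξ : E) (x : ι) (i : I) : ℝ :=
  ⟪A x i, ξ⟫ / smoothNorm (fun j => ⟪A x j, ξ⟫)

theorem hasDerivAt_gordonField_rotL (A B : ι → I → E) (a b : ι → E) (ξ : E) (x : ι) (θ : ℝ) :
    HasDerivAt (fun t => gordonField (fun x i => rotL t (A x i) (B x i))
        (fun x => rotL t (a x) (b x)) ξ x)
      (∑ i, gordonDir (fun x i => rotL θ (A x i) (B x i)) ξ x i * ⟪rotR θ (A x i) (B x i), ξ⟫ +
        ⟪rotR θ (a x) (b x), ξ⟫) θ :=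
  (hasDerivAt_smoothNorm fun _ => hasDerivAt_rotL θ _ _ ξ).add (hasDerivAt_rotL θ _ _ ξ)

theorem hasDerivAt_gordonField_line (A : ι → I → E) (a : ι → E) (ξ v : E) (x : ι) :
    HasDerivAt (fun s : ℝ => gordonField A a (ξ + s • v) x)
      (∑ i, gordonDir A ξ x i * ⟪A x i, v⟫ + ⟪a x, v⟫) 0 := by
  have h : ∀ w : E, HasDerivAt (fun s : ℝ => ⟪w, ξ + s • v⟫) ⟪w, v⟫ 0 := by
    intro w
    simp only [inner_add_right, inner_smul_right]
    simpa using! ((hasDerivAt_id (0 : ℝ)).mul_const ⟪w, v⟫).const_add ⟪w, ξ⟫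
  have h1 := (hasDerivAt_smoothNorm fun i => h (A x i)).add (h (a x))
  simpa [gordonDir] using! h1

theorem continuous_gordonField (A : ι → I → E) (a : ι → E) (x : ι) :
    Continuous fun ξ => gordonField A a ξ x := by
  unfold gordonField
  exact (continuous_smoothNorm fun i => by fun_prop).add (by fun_prop)

theorem continuous_gordonDir (A : ι → I → E) (x : ι) (i : I) :
    Continuous fun ξ => gordonDir A ξ x i := by
  unfold gordonDir
  exact Continuous.div (by fun_prop) (continuous_smoothNorm fun i => by fun_prop)
    fun ξ => (smoothNorm_pos _).ne'

theorem abs_gordonDir_le (A : ι → I → E) (ξ : E) (x : ι) (i : I) : |gordonDir A ξ x i| ≤ 1 :=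
  abs_div_smoothNorm_le (fun j => ⟪A x j, ξ⟫) i

/-- Applied to the velocity `v` of the vector part at `x`, which is orthogonal to the process at the
same point, this leaves only the Gibbs weight to be differentiated in the integration by parts. -/
theorem gordonDir_line {A : ι → I → E} {v : E} {x : ι} (h : ∀ j, ⟪A x j, v⟫ = 0) (ξ : E) (s : ℝ)
    (i : I) : gordonDir A (ξ + s • v) x i = gordonDir A ξ x i := by
  simp [gordonDir, inner_add_right, inner_smul_right, h]

variable [Fintype ι] [FiniteDimensional ℝ E] [MeasurableSpace E] [BorelSpace E] [Nonempty ι]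

theorem integrable_softMin_gordonField (A : ι → I → E) (a : ι → E) {β : ℝ} (hβ : 0 < β) :
    Integrable (fun ξ => softMin β (gordonField A a ξ)) (stdGaussian E) := by
  have hi : ∀ v : E, Integrable (fun ξ => ⟪v, ξ⟫) (stdGaussian E) := fun v =>
    (innerSL ℝ v).integrable_comp IsGaussian.integrable_id
  have hdom : Integrable (fun ξ => ∑ x, (1 + ∑ i, |⟪A x i, ξ⟫| + |⟪a x, ξ⟫|) +
      β⁻¹ * Real.log (Fintype.card ι)) (stdGaussian E) := by
    refine (integrable_finsetSum _ fun x _ => ?_).add (integrable_const _)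
    refine ((integrable_const _).add ?_).add (hi _).abs
    exact integrable_finsetSum _ fun i _ => (hi _).abs
  refine hdom.mono' (continuous_softMin fun x => continuous_gordonField A a x).aestronglyMeasurable
    (ae_of_all _ fun ξ => (abs_softMin_le hβ _).trans ?_)
  gcongr with x
  rw [gordonField]
  refine (abs_add_le _ _).trans ?_
  rw [abs_of_pos (smoothNorm_pos _)]
  gcongr
  exact smoothNorm_le _

namespace IsGordonPair

variable [DecidableEq I] {K : ι → ι → ℝ} {A B : ι → I → E} {a b : ι → E}

/-- The derivative of the interpolation between the two processes. -/
theorem hasDerivAt_integral_softMin (hp : IsGordonPair K A B a b) {β : ℝ} (hβ : 0 < β) (θ : ℝ) :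
    HasDerivAt (fun t => ∫ ξ, softMin β (gordonField (fun x i => rotL t (A x i) (B x i))
        (fun x => rotL t (a x) (b x)) ξ) ∂(stdGaussian E))
      (∫ ξ, ∑ x, gibbsWeight β (gordonField (fun x i => rotL θ (A x i) (B x i))
          (fun x => rotL θ (a x) (b x)) ξ) x *
        (∑ i, gordonDir (fun x i => rotL θ (A x i) (B x i)) ξ x i * ⟪rotR θ (A x i) (B x i), ξ⟫ +
          ⟪rotR θ (a x) (b x), ξ⟫) ∂(stdGaussian E)) θ := by
  have hin : ∀ v ξ : E, ‖v‖ = 1 → |⟪v, ξ⟫| ≤ ‖ξ‖ := fun v ξ hv => by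
    simpa [hv] using abs_real_inner_le_norm v ξ
  -- The dominating function does not depend on the angle: weights and directions are at most one in
  -- absolute value and the rotated functionals are unit vectors.
  refine (hasDerivAt_integral_of_dominated_loc_of_deriv_le (s := Set.univ) Filter.univ_mem
    (bound := fun ξ => ∑ _x : ι, (∑ _i : I, ‖ξ‖ + ‖ξ‖))
    (Eventually.of_forall fun t => ?_) (integrable_softMin_gordonField _ _ hβ) ?_
    (ae_of_all _ fun ξ t _ => ?_) ?_
    (ae_of_all _ fun ξ t _ => hasDerivAt_softMin hβ fun x =>
      hasDerivAt_gordonField_rotL A B a b ξ x t)).2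
  · exact (continuous_softMin fun x => continuous_gordonField _ _ x).aestronglyMeasurable
  · refine Continuous.aestronglyMeasurable (continuous_finsetSum _ fun x _ => ?_)
    refine (continuous_gibbsWeight (fun x => continuous_gordonField _ _ x) x).mul
      ((continuous_finsetSum _ fun i _ => ?_).add (by fun_prop))
    exact (continuous_gordonDir _ x i).mul (by fun_prop)
  · refine (norm_sum_le _ _).trans (Finset.sum_le_sum fun x _ => ?_)
    rw [Real.norm_eq_abs, abs_mul]
    refine (mul_le_of_le_one_left (abs_nonneg _) (abs_gibbsWeight_le_one _ _ _)).trans ?_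
    refine (abs_add_le _ _).trans (add_le_add ?_ (hin _ _ (hp.norm_rotR_scalar t x)))
    refine (Finset.abs_sum_le_sum_abs _ _).trans (Finset.sum_le_sum fun i _ => ?_)
    rw [abs_mul]
    exact (mul_le_of_le_one_left (abs_nonneg _) (abs_gordonDir_le _ _ _ _)).trans
      (hin _ _ (hp.norm_rotR_vector t x i))
  · refine integrable_finsetSum _ fun x _ => Integrable.add ?_ integrable_norm_stdGaussian
    exact integrable_finsetSum _ fun i _ => integrable_norm_stdGaussian

/-- Integration by parts along the velocity of one vector coordinate. Since `K x x = 1`, neither the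
direction nor the field at `x` moves, and the derivative comes entirely from the normalization of
the Gibbs weight. -/
theorem integral_inner_mul_gibbsWeight_mul_gordonDir (hp : IsGordonPair K A B a b) {β : ℝ}
    (hβ : 0 < β) (θ : ℝ) (x : ι) (i : I) :
    Integrable (fun ξ => (β * gibbsWeight β (gordonField (fun x i => rotL θ (A x i) (B x i))
          (fun x => rotL θ (a x) (b x)) ξ) x *
        ∑ y, gibbsWeight β (gordonField (fun x i => rotL θ (A x i) (B x i))
          (fun x => rotL θ (a x) (b x)) ξ) y *
          (gordonDir (fun x i => rotL θ (A x i) (B x i)) ξ y i *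
            (Real.sin θ * Real.cos θ * (1 - K x y)))) *
        gordonDir (fun x i => rotL θ (A x i) (B x i)) ξ x i)
        (stdGaussian E) ∧
    ∫ ξ, ⟪rotR θ (A x i) (B x i), ξ⟫ *
        (gibbsWeight β (gordonField (fun x i => rotL θ (A x i) (B x i))
          (fun x => rotL θ (a x) (b x)) ξ) x *
          gordonDir (fun x i => rotL θ (A x i) (B x i)) ξ x i) ∂(stdGaussian E) =
      ∫ ξ, (β * gibbsWeight β (gordonField (fun x i => rotL θ (A x i) (B x i))
          (fun x => rotL θ (a x) (b x)) ξ) x *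
        ∑ y, gibbsWeight β (gordonField (fun x i => rotL θ (A x i) (B x i))
          (fun x => rotL θ (a x) (b x)) ξ) y *
          (gordonDir (fun x i => rotL θ (A x i) (B x i)) ξ y i *
            (Real.sin θ * Real.cos θ * (1 - K x y)))) *
        gordonDir (fun x i => rotL θ (A x i) (B x i)) ξ x i ∂(stdGaussian E) := by
  set At := fun x i => rotL θ (A x i) (B x i) with hAt
  set at' := fun x => rotL θ (a x) (b x) with hat
  set v := rotR θ (A x i) (B x i) with hv
  have hAv : ∀ y j, ⟪At y j, v⟫ =
      if i = j then Real.sin θ * Real.cos θ * (1 - K x y) else 0 := fun y j => by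
    rw [real_inner_comm]; exact hp.inner_rotR_rotL_same θ x y i j
  have hav : ∀ y, ⟪at' y, v⟫ = 0 := fun y => by
    rw [real_inner_comm]; exact hp.inner_rotR_rotL_cross θ x y i
  have hAxv : ∀ j, ⟪At x j, v⟫ = 0 := fun j => by simp [hAv, hp.diag]
  have hfd : ∀ ξ y, HasDerivAt (fun s : ℝ => gordonField At at' (ξ + s • v) y)
      (gordonDir At ξ y i * (Real.sin θ * Real.cos θ * (1 - K x y))) 0 := fun ξ y => by
    refine (hasDerivAt_gordonField_line At at' ξ v y).congr_deriv ?_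
    simp [hAv, hav]
  have hK : ∀ y, 0 ≤ 1 - K x y := fun y => sub_nonneg.2 (hp.le_one x y)
  have hsc : |Real.sin θ * Real.cos θ| ≤ 1 := by
    rw [abs_mul]
    exact mul_le_one₀ (Real.abs_sin_le_one _) (abs_nonneg _) (Real.abs_cos_le_one _)
  -- One constant for two bounds: the `1` covers the function and the sum covers its derivative.
  refine integral_inner_mul_stdGaussian (C := 1 + β * ∑ y, (1 - K x y))
    (hp.norm_rotR_vector θ x i) (fun ξ => ?_) ?_ ?_ (fun ξ => ?_) (fun ξ => ?_)
  · simp_rw [← hv, gordonDir_line hAxv]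
    refine HasDerivAt.mul_const ?_ _
    refine (hasDerivAt_gibbsWeight (β := β) (hfd ξ) x).congr_deriv ?_
    simp [hp.diag]
  · exact (continuous_gibbsWeight (fun x => continuous_gordonField _ _ x) x).mul
      (continuous_gordonDir _ x i)
  · refine Continuous.mul ((continuous_const.mul
      (continuous_gibbsWeight (fun x => continuous_gordonField _ _ x) x)).mul
      (continuous_finsetSum _ fun y _ => ?_)) (continuous_gordonDir _ x i)
    exact (continuous_gibbsWeight (fun x => continuous_gordonField _ _ x) y).mul
      ((continuous_gordonDir _ y i).mul continuous_const)
  · rw [abs_mul]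
    refine (mul_le_one₀ (abs_gibbsWeight_le_one _ _ _) (abs_nonneg _)
      (abs_gordonDir_le _ _ _ _)).trans ?_
    have := Finset.sum_nonneg fun y (_ : y ∈ Finset.univ) => hK y
    nlinarith
  · rw [abs_mul, abs_mul, abs_mul, abs_of_pos hβ]
    have h1 : |∑ y, gibbsWeight β (gordonField At at' ξ) y * (gordonDir At ξ y i *
        (Real.sin θ * Real.cos θ * (1 - K x y)))| ≤ ∑ y, (1 - K x y) := by
      refine (Finset.abs_sum_le_sum_abs _ _).trans (Finset.sum_le_sum fun y _ => ?_)
      rw [abs_mul, abs_mul, abs_mul, abs_of_nonneg (hK y)]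
      refine (mul_le_of_le_one_left (by have := hK y; positivity)
        (abs_gibbsWeight_le_one _ _ _)).trans ?_
      refine (mul_le_of_le_one_left (by have := hK y; positivity)
        (abs_gordonDir_le _ _ _ _)).trans ?_
      exact mul_le_of_le_one_left (hK y) hsc
    have h2 := abs_gibbsWeight_le_one β (gordonField At at' ξ) x
    have h3 := abs_gordonDir_le At ξ x i
    calc _ ≤ β * 1 * (∑ y, (1 - K x y)) * 1 := by
          have := (abs_nonneg _).trans h1
          gcongr
      _ ≤ _ := by linarith

/-- The scalar counterpart, with the opposite covariance and no direction factor. -/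
theorem integral_inner_mul_gibbsWeight (hp : IsGordonPair K A B a b) {β : ℝ}
    (hβ : 0 < β) (θ : ℝ) (x : ι) :
    Integrable (fun ξ => β * gibbsWeight β (gordonField (fun x i => rotL θ (A x i) (B x i))
          (fun x => rotL θ (a x) (b x)) ξ) x *
        ∑ y, gibbsWeight β (gordonField (fun x i => rotL θ (A x i) (B x i))
          (fun x => rotL θ (a x) (b x)) ξ) y *
          (-(Real.sin θ * Real.cos θ * (1 - K x y))))
        (stdGaussian E) ∧
    ∫ ξ, ⟪rotR θ (a x) (b x), ξ⟫ *
        gibbsWeight β (gordonField (fun x i => rotL θ (A x i) (B x i))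
          (fun x => rotL θ (a x) (b x)) ξ) x ∂(stdGaussian E) =
      ∫ ξ, β * gibbsWeight β (gordonField (fun x i => rotL θ (A x i) (B x i))
          (fun x => rotL θ (a x) (b x)) ξ) x *
        ∑ y, gibbsWeight β (gordonField (fun x i => rotL θ (A x i) (B x i))
          (fun x => rotL θ (a x) (b x)) ξ) y *
          (-(Real.sin θ * Real.cos θ * (1 - K x y))) ∂(stdGaussian E) := by
  set At := fun x i => rotL θ (A x i) (B x i) with hAt
  set at' := fun x => rotL θ (a x) (b x) with hat
  set v := rotR θ (a x) (b x) with hv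
  have hAv : ∀ y j, ⟪At y j, v⟫ = 0 := fun y j => by
    rw [real_inner_comm]; exact hp.inner_rotR_rotL_cross' θ y x j
  have hav : ∀ y, ⟪at' y, v⟫ = -(Real.sin θ * Real.cos θ * (1 - K x y)) := fun y => by
    rw [real_inner_comm]; exact hp.inner_rotR_rotL_scalar θ x y
  have hfd : ∀ ξ y, HasDerivAt (fun s : ℝ => gordonField At at' (ξ + s • v) y)
      (-(Real.sin θ * Real.cos θ * (1 - K x y))) 0 := fun ξ y => by
    refine (hasDerivAt_gordonField_line At at' ξ v y).congr_deriv ?_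
    simp [hAv, hav]
  have hK : ∀ y, 0 ≤ 1 - K x y := fun y => sub_nonneg.2 (hp.le_one x y)
  have hsc : |Real.sin θ * Real.cos θ| ≤ 1 := by
    rw [abs_mul]
    exact mul_le_one₀ (Real.abs_sin_le_one _) (abs_nonneg _) (Real.abs_cos_le_one _)
  refine integral_inner_mul_stdGaussian (C := 1 + β * ∑ y, (1 - K x y))
    (hp.norm_rotR_scalar θ x) (fun ξ => ?_) ?_ ?_ (fun ξ => ?_) (fun ξ => ?_)
  · refine (hasDerivAt_gibbsWeight (β := β) (hfd ξ) x).congr_deriv ?_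
    simp [hp.diag]
  · exact continuous_gibbsWeight (fun x => continuous_gordonField _ _ x) x
  · refine (continuous_const.mul
      (continuous_gibbsWeight (fun x => continuous_gordonField _ _ x) x)).mul
      (continuous_finsetSum _ fun y _ => ?_)
    exact (continuous_gibbsWeight (fun x => continuous_gordonField _ _ x) y).mul continuous_const
  · refine (abs_gibbsWeight_le_one _ _ _).trans ?_
    have := Finset.sum_nonneg fun y (_ : y ∈ Finset.univ) => hK y
    nlinarith
  · rw [abs_mul, abs_mul, abs_of_pos hβ]
    have h1 : |∑ y, gibbsWeight β (gordonField At at' ξ) y *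
        (-(Real.sin θ * Real.cos θ * (1 - K x y)))| ≤ ∑ y, (1 - K x y) := by
      refine (Finset.abs_sum_le_sum_abs _ _).trans (Finset.sum_le_sum fun y _ => ?_)
      rw [abs_mul, abs_neg, abs_mul, abs_of_nonneg (hK y)]
      refine (mul_le_of_le_one_left (by have := hK y; positivity)
        (abs_gibbsWeight_le_one _ _ _)).trans ?_
      exact mul_le_of_le_one_left (hK y) hsc
    have h2 := abs_gibbsWeight_le_one β (gordonField At at' ξ) x
    calc _ ≤ β * 1 * (∑ y, (1 - K x y)) := by
          have := (abs_nonneg _).trans h1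
          gcongr
      _ ≤ _ := by linarith

/-- **Gordon's comparison theorem** for the soft minimum of the (smoothed) norm. -/
theorem integral_softMin_le (hp : IsGordonPair K A B a b) {β : ℝ} (hβ : 0 < β) :
    ∫ ξ, softMin β (gordonField B b ξ) ∂(stdGaussian E) ≤
      ∫ ξ, softMin β (gordonField A a ξ) ∂(stdGaussian E) := by
  have hin : ∀ v : E, Integrable (fun ξ => ⟪v, ξ⟫) (stdGaussian E) := fun v =>
    (innerSL ℝ v).integrable_comp IsGaussian.integrable_id
  have hder := hp.hasDerivAt_integral_softMin hβ
  -- Angle `0` is the matrix process and angle `π/2` the decoupled one, so it is enough that the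
  -- interpolation decreases between them.
  have hanti := antitoneOn_of_deriv_nonpos (convex_Icc 0 (Real.pi / 2))
    (fun θ _ => (hder θ).continuousAt.continuousWithinAt)
    (fun θ _ => (hder θ).differentiableAt.differentiableWithinAt) (fun θ hθ => ?_)
  · have h := hanti (Set.left_mem_Icc.2 (by positivity)) (Set.right_mem_Icc.2 (by positivity))
      (by positivity : (0 : ℝ) ≤ Real.pi / 2)
    simpa [rotL] using h
  rw [(hder θ).deriv]
  rw [interior_Icc] at hθ
  have hs : 0 ≤ Real.sin θ * Real.cos θ :=
    mul_nonneg (Real.sin_nonneg_of_nonneg_of_le_pi hθ.1.le (by linarith [hθ.2, Real.pi_pos]))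
      (Real.cos_nonneg_of_mem_Icc ⟨by linarith [hθ.1, Real.pi_pos], hθ.2.le⟩)
  have hI1 : ∀ x i, Integrable (fun ξ => ⟪rotR θ (A x i) (B x i), ξ⟫ *
      (gibbsWeight β (gordonField (fun x i => rotL θ (A x i) (B x i))
          (fun x => rotL θ (a x) (b x)) ξ) x *
          gordonDir (fun x i => rotL θ (A x i) (B x i)) ξ x i)) (stdGaussian E) := fun x i => by
    refine (hin _).mul_bdd (c := 1) ((continuous_gibbsWeight
      (fun x => continuous_gordonField _ _ x) x).mul
      (continuous_gordonDir _ x i)).aestronglyMeasurable (ae_of_all _ fun ξ => ?_)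
    rw [Real.norm_eq_abs, abs_mul]
    exact mul_le_one₀ (abs_gibbsWeight_le_one _ _ _) (abs_nonneg _) (abs_gordonDir_le _ _ _ _)
  have hI2 : ∀ x, Integrable (fun ξ => ⟪rotR θ (a x) (b x), ξ⟫ *
      gibbsWeight β (gordonField (fun x i => rotL θ (A x i) (B x i))
          (fun x => rotL θ (a x) (b x)) ξ) x) (stdGaussian E) := fun x => by
    exact (hin _).mul_bdd (c := 1) (continuous_gibbsWeight
      (fun x => continuous_gordonField _ _ x) x).aestronglyMeasurable
      (ae_of_all _ fun ξ => abs_gibbsWeight_le_one _ _ _)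
  have hsplit : ∀ ξ : E, ∑ x, gibbsWeight β (gordonField (fun x i => rotL θ (A x i) (B x i))
          (fun x => rotL θ (a x) (b x)) ξ) x *
        (∑ i, gordonDir (fun x i => rotL θ (A x i) (B x i)) ξ x i * ⟪rotR θ (A x i) (B x i), ξ⟫ +
          ⟪rotR θ (a x) (b x), ξ⟫) =
      ∑ x, (∑ i, ⟪rotR θ (A x i) (B x i), ξ⟫ *
        (gibbsWeight β (gordonField (fun x i => rotL θ (A x i) (B x i))
          (fun x => rotL θ (a x) (b x)) ξ) x *
          gordonDir (fun x i => rotL θ (A x i) (B x i)) ξ x i) + ⟪rotR θ (a x) (b x), ξ⟫ *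
      gibbsWeight β (gordonField (fun x i => rotL θ (A x i) (B x i))
          (fun x => rotL θ (a x) (b x)) ξ) x) := fun ξ => by
    refine Finset.sum_congr rfl fun x _ => ?_
    rw [mul_add, Finset.mul_sum]
    congr 1
    · exact Finset.sum_congr rfl fun i _ => by ring
    · ring
  simp_rw [hsplit]
  have hI3 : ∀ x, Integrable (fun ξ => ∑ i, ⟪rotR θ (A x i) (B x i), ξ⟫ *
      (gibbsWeight β (gordonField (fun x i => rotL θ (A x i) (B x i))
          (fun x => rotL θ (a x) (b x)) ξ) x *
          gordonDir (fun x i => rotL θ (A x i) (B x i)) ξ x i)) (stdGaussian E) := fun x =>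
    integrable_finsetSum _ fun i _ => hI1 x i
  rw [integral_finsetSum]
  swap
  · exact fun x _ => (hI3 x).add (hI2 x)
  refine Finset.sum_nonpos fun x _ => ?_
  have h1 := hp.integral_inner_mul_gibbsWeight_mul_gordonDir hβ θ x
  have h2 := hp.integral_inner_mul_gibbsWeight hβ θ x
  rw [integral_add (hI3 x) (hI2 x), integral_finsetSum _ fun i _ => hI1 x i, h2.2,
    Finset.sum_congr rfl fun i _ => (h1 i).2, ← integral_finsetSum _ fun i _ => (h1 i).1,
    ← integral_add (integrable_finsetSum _ fun i _ => (h1 i).1) h2.1]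
  refine integral_nonpos fun ξ => ?_
  set p := gibbsWeight β (gordonField (fun x i => rotL θ (A x i) (B x i))
    (fun x => rotL θ (a x) (b x)) ξ)
  set n := gordonDir (fun x i => rotL θ (A x i) (B x i)) ξ
  have hp0 : ∀ x, 0 ≤ p x := gibbsWeight_nonneg _ _
  have hn : ∀ y, ∑ i, n x i * n y i ≤ 1 := fun y => sum_mul_div_smoothNorm_le _ _
  -- Vector and scalar contributions differ only by the factor `-∑ i, n x i * n y i`. Their sum is
  -- minus a sum of products of nonnegative terms, `1 - K x y` and `1 - ∑ i, n x i * n y i` among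
  -- them.
  have heq : ∑ i, β * p x * (∑ y, p y * (n y i * (Real.sin θ * Real.cos θ * (1 - K x y)))) *
        n x i + β * p x * ∑ y, p y * -(Real.sin θ * Real.cos θ * (1 - K x y)) =
      -(β * p x * ∑ y, p y * (Real.sin θ * Real.cos θ * (1 - K x y)) *
        (1 - ∑ i, n x i * n y i)) := by
    have h3 : ∑ i, β * p x * (∑ y, p y * (n y i * (Real.sin θ * Real.cos θ * (1 - K x y)))) *
        n x i = β * p x * ∑ y, p y * (Real.sin θ * Real.cos θ * (1 - K x y)) *
          ∑ i, n x i * n y i := by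
      simp_rw [Finset.mul_sum, Finset.sum_mul]
      rw [Finset.sum_comm]
      exact Finset.sum_congr rfl fun y _ => Finset.sum_congr rfl fun i _ => by ring
    rw [h3, ← mul_add, ← mul_neg, ← Finset.sum_add_distrib, ← Finset.sum_neg_distrib]
    congr 1
    exact Finset.sum_congr rfl fun y _ => by ring
  refine heq.trans_le (neg_nonpos.2 (mul_nonneg (mul_nonneg hβ.le (hp0 x))
    (Finset.sum_nonneg fun y _ => ?_)))
  exact mul_nonneg (mul_nonneg (hp0 y) (mul_nonneg hs (sub_nonneg.2 (hp.le_one x y))))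
    (sub_nonneg.2 (hn y))

end IsGordonPair

end GordonComparison

/-! ### Concentration of the soft minimum and Gordon's escape theorem. -/

section GordonEscape

open scoped RealInnerProductSpace

section Orthonormal

variable {E : Type*} [NormedAddCommGroup E] [InnerProductSpace ℝ E]
  {I : Type*} [Fintype I]

theorem sum_inner_sq_le_norm_sq {v : I → E} (hv : Orthonormal ℝ v) (ξ : E) :
    ∑ i, ⟪v i, ξ⟫ ^ 2 ≤ ‖ξ‖ ^ 2 := by
  have := hv.sum_inner_products_le (s := Finset.univ) ξ
  simpa using this

theorem contDiff_smoothNorm_inner (v : I → E) :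
    ContDiff ℝ 1 fun ξ => smoothNorm fun i => ⟪v i, ξ⟫ := by
  unfold smoothNorm
  refine ContDiff.sqrt ?_ fun ξ => (by positivity)
  exact contDiff_const.add (ContDiff.sum fun i _ => (contDiff_const.inner ℝ contDiff_id).pow 2)

theorem abs_sum_gordonDir_mul_inner_le {ι : Type*} {A : ι → I → E} {x : ι}
    (hv : Orthonormal ℝ (A x)) (ξ w : E) : |∑ i, gordonDir A ξ x i * ⟪A x i, w⟫| ≤ ‖w‖ := by
  refine abs_le_of_sq_le_sq ?_ (norm_nonneg _)
  refine (Finset.sum_mul_sq_le_sq_mul_sq _ _ _).trans ?_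
  calc _ ≤ 1 * ‖w‖ ^ 2 := by
        gcongr
        · exact sum_sq_div_smoothNorm_le _
        · exact sum_inner_sq_le_norm_sq hv w
    _ = _ := one_mul _

theorem contDiff_softMin_smoothNorm {ι : Type*} [Fintype ι] [Nonempty ι] (β : ℝ)
    (A : ι → I → E) :
    ContDiff ℝ 1 fun ξ => softMin β fun x => smoothNorm fun i => ⟪A x i, ξ⟫ := by
  unfold softMin
  refine contDiff_const.mul (ContDiff.log (ContDiff.sum fun x _ => ?_)
    fun ξ => (sum_exp_pos β _).ne')
  exact (contDiff_const.mul (contDiff_smoothNorm_inner (A x))).exp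

/-- The gradient is a Gibbs average of vectors of norm at most one, hence a bound independent of the
dimension and of the size of the family. -/
theorem norm_fderiv_softMin_smoothNorm_le {ι : Type*} [Fintype ι] [Nonempty ι] {β : ℝ}
    (hβ : 0 < β) {A : ι → I → E} (hA : ∀ x, Orthonormal ℝ (A x)) (ξ : E) :
    ‖fderiv ℝ (fun ξ => softMin β fun x => smoothNorm fun i => ⟪A x i, ξ⟫) ξ‖ ≤ 1 := by
  refine ContinuousLinearMap.opNorm_le_bound _ zero_le_one fun w => ?_
  have h1 := ((contDiff_softMin_smoothNorm β A).differentiable one_ne_zero ξ).hasFDerivAt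
  have h2 : HasDerivAt (fun s : ℝ => ξ + s • w) w 0 := by
    simpa using ((hasDerivAt_id (0 : ℝ)).smul_const w).const_add ξ
  have h3 := HasFDerivAt.comp_hasDerivAt_of_eq (0 : ℝ) h1 h2 (by simp)
  have h4 := hasDerivAt_softMin (β := β) hβ fun x => hasDerivAt_gordonField_line A 0 ξ w x
  have h5 := h3.unique (h4.congr_of_eventuallyEq (Eventually.of_forall fun s => by
    simp only [Function.comp_def]
    congr 1
    ext x
    simp [gordonField]))
  rw [h5, one_mul, Real.norm_eq_abs]
  calc _ ≤ ∑ x, gibbsWeight β (gordonField A 0 (ξ + (0 : ℝ) • w)) x * ‖w‖ := by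
        refine (Finset.abs_sum_le_sum_abs _ _).trans (Finset.sum_le_sum fun x _ => ?_)
        rw [abs_mul, abs_of_nonneg (gibbsWeight_nonneg _ _ _)]
        refine mul_le_mul_of_nonneg_left ?_ (gibbsWeight_nonneg _ _ _)
        simpa using abs_sum_gordonDir_mul_inner_le (hA x) ξ w
    _ = ‖w‖ := by rw [← Finset.sum_mul, sum_gibbsWeight, one_mul]

/-- Through a one-point family, the moment bounds for `softMin` apply to `smoothNorm` itself. -/
theorem softMin_unit {β : ℝ} (hβ : β ≠ 0) (f : Unit → ℝ) : softMin β f = f () := by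
  simp [softMin, Real.log_exp]
  field_simp

theorem softMin_add_const {ι : Type*} [Fintype ι] [Nonempty ι] {β : ℝ} (hβ : β ≠ 0) (f : ι → ℝ)
    (c : ℝ) : softMin β (fun x => f x + c) = softMin β f + c := by
  have h : ∑ x, Real.exp (-β * (f x + c)) = Real.exp (-β * c) * ∑ x, Real.exp (-β * f x) := by
    rw [Finset.mul_sum]
    exact Finset.sum_congr rfl fun x _ => by rw [← Real.exp_add]; ring_nf
  rw [softMin, softMin, h, Real.log_mul (Real.exp_pos _).ne' (sum_exp_pos β f).ne', Real.log_exp]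
  field_simp
  ring

variable [FiniteDimensional ℝ E] [MeasurableSpace E] [BorelSpace E]

theorem pi_sq_div_eight_le_two : Real.pi ^ 2 / 8 ≤ 2 := by
  nlinarith [Real.pi_le_four, Real.pi_pos]

theorem variance_softMin_smoothNorm_le {ι : Type*} [Fintype ι] [Nonempty ι] {β : ℝ}
    (hβ : 0 < β) {A : ι → I → E} (hA : ∀ x, Orthonormal ℝ (A x)) :
    Var[fun ξ => softMin β fun x => smoothNorm fun i => ⟪A x i, ξ⟫; stdGaussian E] ≤ 2 := by
  have := variance_stdGaussian_le (contDiff_softMin_smoothNorm β A)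
    (norm_fderiv_softMin_smoothNorm_le hβ hA)
  linarith [pi_sq_div_eight_le_two]

theorem memLp_softMin_smoothNorm {ι : Type*} [Fintype ι] [Nonempty ι] {β : ℝ}
    (hβ : 0 < β) {A : ι → I → E} (hA : ∀ x, Orthonormal ℝ (A x)) :
    MemLp (fun ξ => softMin β fun x => smoothNorm fun i => ⟪A x i, ξ⟫) 2 (stdGaussian E) :=
  memLp_two_of_norm_fderiv_le (contDiff_softMin_smoothNorm β A)
    (norm_fderiv_softMin_smoothNorm_le hβ hA)

theorem memLp_smoothNorm {v : I → E} (hv : Orthonormal ℝ v) :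
    MemLp (fun ξ => smoothNorm fun i => ⟪v i, ξ⟫) 2 (stdGaussian E) := by
  have := memLp_softMin_smoothNorm (ι := Unit) one_pos fun _ => hv
  simpa only [softMin_unit one_ne_zero] using this

/-- The second moment is `1 + card I` and the variance is at most `2`, so the squared mean is at
least `card I - 1`. -/
theorem sqrt_card_sub_one_le_integral_smoothNorm {v : I → E} (hv : Orthonormal ℝ v) :
    √((Fintype.card I : ℝ) - 1) ≤ ∫ ξ, smoothNorm (fun i => ⟪v i, ξ⟫) ∂(stdGaussian E) := by
  have hvar := variance_softMin_smoothNorm_le (ι := Unit) one_pos fun _ => hv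
  simp only [softMin_unit one_ne_zero] at hvar
  rw [variance_eq_sub (memLp_smoothNorm hv)] at hvar
  have h2 : ∫ ξ, ((fun ξ => smoothNorm fun i => ⟪v i, ξ⟫) ^ 2) ξ ∂(stdGaussian E) =
      1 + Fintype.card I := by
    simp only [Pi.pow_apply, smoothNorm_sq]
    have hi : ∀ i, Integrable (fun ξ => ⟪v i, ξ⟫ ^ 2) (stdGaussian E) := fun i =>
      (IsGaussian.memLp_dual (stdGaussian E) (innerSL ℝ (v i)) 2 (by norm_num)).integrable_sq
    rw [integral_add (integrable_const _) (integrable_finsetSum _ fun i _ => hi i),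
      integral_finsetSum _ fun i _ => hi i]
    have : ∀ i, ∫ ξ, ⟪v i, ξ⟫ ^ 2 ∂(stdGaussian E) = 1 := fun i => by
      have := integral_strongDual_sq_stdGaussian (innerSL ℝ (v i))
      simpa [hv.1 i] using this
    simp [this]
  rw [h2] at hvar
  refine Real.sqrt_le_iff.2 ⟨integral_nonneg fun ξ => (smoothNorm_pos _).le, ?_⟩
  linarith

/-- Extracts the matrix or vector blocks of a large Gaussian vector as standard Gaussians; it also
gives rotation invariance of the Gaussian matrix. -/
theorem map_inner_orthonormal_stdGaussian {v : I → E} (hv : Orthonormal ℝ v) :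
    (stdGaussian E).map (fun ξ => WithLp.toLp 2 fun i => ⟪v i, ξ⟫) =
      stdGaussian (EuclideanSpace ℝ I) := by
  have hm : Measurable fun ξ : E => WithLp.toLp 2 fun i => ⟪v i, ξ⟫ :=
    Continuous.measurable (by fun_prop)
  have := Measure.isProbabilityMeasure_map (μ := stdGaussian E) hm.aemeasurable
  apply Measure.ext_of_charFun
  ext t
  have hn : ‖∑ i, t i • v i‖ ^ 2 = ‖t‖ ^ 2 := by
    rw [← real_inner_self_eq_norm_sq, hv.inner_sum, EuclideanSpace.real_norm_sq_eq]
    simp [pow_two]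
  have hn' : (‖∑ i, t i • v i‖ : ℂ) ^ 2 = (‖t‖ : ℂ) ^ 2 := by exact_mod_cast hn
  rw [charFun_stdGaussian, ← hn', ← charFun_stdGaussian, charFun_apply, charFun_apply,
    integral_map hm.aemeasurable (Measurable.aestronglyMeasurable (by fun_prop))]
  congr 1
  ext ξ
  congr 3
  simp only [PiLp.inner_apply, inner_sum, inner_smul_right]
  exact Finset.sum_congr rfl fun i _ => by simp [real_inner_comm]

end Orthonormal

variable {m n : ℕ}

/-- The index type of a Gaussian vector made of an `m × n` matrix, a scalar, an `m`-vector and an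
`n`-vector. -/
abbrev GordonIndex (m n : ℕ) : Type := (Fin m × Fin n) ⊕ (Unit ⊕ (Fin m ⊕ Fin n))

/-- The functional `(G, γ, h, g) ↦ (G x)ᵢ`. -/
noncomputable def matrixRow (x : EuclideanSpace ℝ (Fin n)) (i : Fin m) :
    EuclideanSpace ℝ (GordonIndex m n) :=
  WithLp.toLp 2 (Sum.elim (fun p => if p.1 = i then x p.2 else 0) fun _ => 0)

/-- The functional `(G, γ, h, g) ↦ hᵢ`. -/
noncomputable def leftCoord (n : ℕ) (i : Fin m) : EuclideanSpace ℝ (GordonIndex m n) :=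
  WithLp.toLp 2 (Sum.elim (fun _ => 0) (Sum.elim (fun _ => 0)
    (Sum.elim (fun j => if j = i then 1 else 0) fun _ => 0)))

/-- The functional `(G, γ, h, g) ↦ γ`. -/
noncomputable def scalarCoord (m n : ℕ) : EuclideanSpace ℝ (GordonIndex m n) :=
  WithLp.toLp 2 (Sum.elim (fun _ => 0) (Sum.elim (fun _ => 1) fun _ => 0))

/-- The functional `(G, γ, h, g) ↦ ⟪x, g⟫`. -/
noncomputable def rightForm (m : ℕ) (x : EuclideanSpace ℝ (Fin n)) :
    EuclideanSpace ℝ (GordonIndex m n) :=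
  WithLp.toLp 2 (Sum.elim (fun _ => 0) (Sum.elim (fun _ => 0) (Sum.elim (fun _ => 0) fun j => x j)))

/-- The fields compared are `‖G x‖ + γ` and `‖h‖ + ⟪x, g⟫`, with smoothed norms; the scalar `γ`
equalizes the variances. -/
theorem isGordonPair_matrix {ι : Type*} {X : ι → EuclideanSpace ℝ (Fin n)}
    (hX : ∀ x, ‖X x‖ = 1) :
    IsGordonPair (fun x y => ⟪X x, X y⟫) (fun x (i : Fin m) => matrixRow (X x) i)
      (fun _ i => leftCoord n i) (fun _ => scalarCoord m n) (fun x => rightForm m (X x)) where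
  diag x := by simp [hX]
  le_one x y := by simpa [hX] using real_inner_le_norm (X x) (X y)
  inner_A_A x y i j := by
    simp only [matrixRow, PiLp.inner_apply, Fintype.sum_sum_type, Fintype.sum_prod_type]
    rw [Finset.sum_eq_single i]
    · split_ifs with h <;> simp [h]
    · intro k _ hk
      simp [hk]
    · simp
  inner_B_B x y i j := by
    simp [leftCoord, PiLp.inner_apply, Fintype.sum_sum_type, eq_comm]
  inner_A_B x y i j := by
    simp [matrixRow, leftCoord, PiLp.inner_apply, Fintype.sum_sum_type]
  inner_a_a x y := by
    simp only [scalarCoord, PiLp.inner_apply, Fintype.sum_sum_type]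
    simp
  inner_b_b x y := by simp [rightForm, PiLp.inner_apply, Fintype.sum_sum_type]
  inner_a_b x y := by simp [scalarCoord, rightForm, PiLp.inner_apply, Fintype.sum_sum_type]
  inner_A_a x y i := by simp [matrixRow, scalarCoord, PiLp.inner_apply, Fintype.sum_sum_type]
  inner_A_b x y i := by simp [matrixRow, rightForm, PiLp.inner_apply, Fintype.sum_sum_type]
  inner_B_a x y i := by simp [leftCoord, scalarCoord, PiLp.inner_apply, Fintype.sum_sum_type]
  inner_B_b x y i := by simp [leftCoord, rightForm, PiLp.inner_apply, Fintype.sum_sum_type]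

/-- The functional `G ↦ (G x)ᵢ` on matrices, seen as vectors. -/
noncomputable def entryRow (x : EuclideanSpace ℝ (Fin n)) (i : Fin m) :
    EuclideanSpace ℝ (Fin m × Fin n) :=
  WithLp.toLp 2 fun p => if p.1 = i then x p.2 else 0

theorem inner_entryRow (x : EuclideanSpace ℝ (Fin n)) (i : Fin m)
    (G : EuclideanSpace ℝ (Fin m × Fin n)) : ⟪entryRow x i, G⟫ = ∑ j, G (i, j) * x j := by
  simp only [entryRow, PiLp.inner_apply, Fintype.sum_prod_type]
  rw [Finset.sum_eq_single i]
  · simp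
  · intro k _ hk
    simp [hk]
  · simp

theorem orthonormal_entryRow {x : EuclideanSpace ℝ (Fin n)} (hx : ‖x‖ = 1) :
    Orthonormal ℝ (entryRow (m := m) x) := by
  rw [orthonormal_iff_ite]
  intro i j
  rw [inner_entryRow]
  by_cases h : i = j
  · have : ∑ k, x k * x k = 1 := by
      have := EuclideanSpace.real_norm_sq_eq x
      rw [hx] at this
      simpa [pow_two] using this.symm
    simpa [entryRow, h] using this
  · simp [entryRow, h]

theorem orthonormal_leftCoord : Orthonormal ℝ (leftCoord (m := m) n) := by
  rw [orthonormal_iff_ite]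
  intro i j
  simp [leftCoord, PiLp.inner_apply, Fintype.sum_sum_type, eq_comm]

/-- The coordinates of the matrix part. -/
noncomputable def matrixCoord (p : Fin m × Fin n) : EuclideanSpace ℝ (GordonIndex m n) :=
  EuclideanSpace.single (Sum.inl p) 1

theorem orthonormal_matrixCoord : Orthonormal ℝ (matrixCoord (m := m) (n := n)) :=
  (EuclideanSpace.orthonormal_single).comp _ Sum.inl_injective

/-- The coordinates of the second vector part, with the opposite sign. -/
noncomputable def negRightCoord (m : ℕ) (j : Fin n) : EuclideanSpace ℝ (GordonIndex m n) :=
  -EuclideanSpace.single (Sum.inr (Sum.inr (Sum.inr j))) 1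

theorem orthonormal_negRightCoord : Orthonormal ℝ (negRightCoord (n := n) m) := by
  rw [orthonormal_iff_ite]
  intro i j
  have h : Orthonormal ℝ fun j : Fin n =>
      EuclideanSpace.single (Sum.inr (Sum.inr (Sum.inr j)) : GordonIndex m n) (1 : ℝ) :=
    EuclideanSpace.orthonormal_single.comp _
      (Sum.inr_injective.comp (Sum.inr_injective.comp Sum.inr_injective))
  rw [negRightCoord, negRightCoord, inner_neg_neg]
  exact orthonormal_iff_ite.1 h i j

theorem inner_matrixRow (x : EuclideanSpace ℝ (Fin n)) (i : Fin m)
    (ξ : EuclideanSpace ℝ (GordonIndex m n)) :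
    ⟪matrixRow x i, ξ⟫ = ⟪entryRow x i, WithLp.toLp 2 fun p => ⟪matrixCoord p, ξ⟫⟫ := by
  simp [matrixRow, entryRow, matrixCoord, PiLp.inner_apply, Fintype.sum_sum_type]

/-- The sign is chosen so that an upper bound on the support function bounds the decoupled field
from below. -/
theorem inner_rightForm (x : EuclideanSpace ℝ (Fin n)) (ξ : EuclideanSpace ℝ (GordonIndex m n)) :
    ⟪rightForm m x, ξ⟫ = -⟪x, WithLp.toLp 2 fun j => ⟪negRightCoord m j, ξ⟫⟫ := by
  simp [rightForm, negRightCoord, PiLp.inner_apply, Fintype.sum_sum_type]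

/-- Gordon's lower bound for the soft minimum of `‖G x‖` over a finite set of unit vectors. -/
theorem le_integral_softMin_matrix {ι : Type*} [Fintype ι] [Nonempty ι]
    {X : ι → EuclideanSpace ℝ (Fin n)} (hX : ∀ x, ‖X x‖ = 1) {β : ℝ} (hβ : 0 < β)
    {s : EuclideanSpace ℝ (Fin n) → ℝ} (hs : Integrable s (stdGaussian _))
    (hsX : ∀ g x, ⟪X x, g⟫ ≤ s g) :
    √((m : ℝ) - 1) - ∫ g, s g ∂(stdGaussian _) - β⁻¹ * Real.log (Fintype.card ι) ≤
      ∫ G, softMin β (fun x => smoothNorm fun i : Fin m => ⟪entryRow (X x) i, G⟫)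
        ∂(stdGaussian (EuclideanSpace ℝ (Fin m × Fin n))) := by
  have hcomp := (isGordonPair_matrix (m := m) hX).integral_softMin_le hβ
  set μ := stdGaussian (EuclideanSpace ℝ (GordonIndex m n)) with hμ
  have hmG : Measurable fun ξ : EuclideanSpace ℝ (GordonIndex m n) =>
      WithLp.toLp 2 fun p : Fin m × Fin n => ⟪matrixCoord p, ξ⟫ :=
    Continuous.measurable (by fun_prop)
  have hmg : Measurable fun ξ : EuclideanSpace ℝ (GordonIndex m n) =>
      WithLp.toLp 2 fun j : Fin n => ⟪negRightCoord m j, ξ⟫ :=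
    Continuous.measurable (by fun_prop)
  have hsc : ∫ ξ, ⟪scalarCoord m n, ξ⟫ ∂μ = 0 :=
    integral_strongDual_stdGaussian (innerSL ℝ (scalarCoord m n))
  -- The scalar is common to all points, so it leaves the soft minimum as an additive term of mean
  -- zero.
  have hG : ∫ ξ, softMin β (gordonField (fun x (i : Fin m) => matrixRow (X x) i)
      (fun _ => scalarCoord m n) ξ) ∂μ =
      ∫ G, softMin β (fun x => smoothNorm fun i : Fin m => ⟪entryRow (X x) i, G⟫)
        ∂(stdGaussian (EuclideanSpace ℝ (Fin m × Fin n))) := by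
    have hint := (memLp_softMin_smoothNorm hβ
      fun x => orthonormal_entryRow (m := m) (hX x)).integrable (by norm_num)
    rw [← map_inner_orthonormal_stdGaussian orthonormal_matrixCoord] at hint ⊢
    rw [integral_map hmG.aemeasurable hint.aestronglyMeasurable]
    have hint' : Integrable (fun ξ => softMin β fun x => smoothNorm fun i : Fin m =>
        ⟪entryRow (X x) i, WithLp.toLp 2 fun p => ⟪matrixCoord p, ξ⟫⟫) μ := hint.comp_measurable hmG
    have hlin : Integrable (fun ξ => ⟪scalarCoord m n, ξ⟫) μ :=
      (innerSL ℝ (scalarCoord m n)).integrable_comp IsGaussian.integrable_id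
    have hfield : ∀ ξ : EuclideanSpace ℝ (GordonIndex m n),
        gordonField (fun x (i : Fin m) => matrixRow (X x) i) (fun _ => scalarCoord m n) ξ =
          fun x => smoothNorm (fun i : Fin m => ⟪entryRow (X x) i,
            WithLp.toLp 2 fun p => ⟪matrixCoord p, ξ⟫⟫) + ⟪scalarCoord m n, ξ⟫ := fun ξ => by
      ext x
      simp only [gordonField, inner_matrixRow]
    simp_rw [hfield, softMin_add_const hβ.ne']
    rw [integral_add hint' hlin, hsc, add_zero]
  rw [← hG]
  refine le_trans ?_ hcomp
  have hint : Integrable (fun ξ => s (WithLp.toLp 2 fun j => ⟪negRightCoord m j, ξ⟫)) μ := by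
    rw [← map_inner_orthonormal_stdGaussian (orthonormal_negRightCoord (m := m))] at hs
    exact hs.comp_measurable hmg
  have hseq : ∫ g, s g ∂(stdGaussian (EuclideanSpace ℝ (Fin n))) =
      ∫ ξ, s (WithLp.toLp 2 fun j => ⟪negRightCoord m j, ξ⟫) ∂μ := by
    have hs' := hs
    rw [← map_inner_orthonormal_stdGaussian (orthonormal_negRightCoord (m := m))] at hs' ⊢
    rw [integral_map hmg.aemeasurable hs'.aestronglyMeasurable]
  have hint2 : Integrable (fun ξ => smoothNorm fun i => ⟪leftCoord n i, ξ⟫) μ :=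
    (memLp_smoothNorm (orthonormal_leftCoord (m := m) (n := n))).integrable (by norm_num)
  have hint3 : Integrable (fun ξ => smoothNorm (fun i => ⟪leftCoord (m := m) n i, ξ⟫) -
      s (WithLp.toLp 2 fun j => ⟪negRightCoord m j, ξ⟫)) μ := hint2.sub hint
  calc _ ≤ ∫ ξ, (smoothNorm (fun i => ⟪leftCoord (m := m) n i, ξ⟫) -
        s (WithLp.toLp 2 fun j => ⟪negRightCoord m j, ξ⟫) - β⁻¹ * Real.log (Fintype.card ι)) ∂μ := by
        rw [integral_sub hint3 (integrable_const _), integral_sub hint2 hint, ← hseq]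
        have := sqrt_card_sub_one_le_integral_smoothNorm (orthonormal_leftCoord (m := m) (n := n))
        simp only [Fintype.card_fin] at this
        simp only [integral_const, probReal_univ, one_smul]
        linarith
    _ ≤ _ := by
        refine integral_mono (hint3.sub (integrable_const _))
          (integrable_softMin_gordonField _ _ hβ) fun ξ => le_softMin hβ fun x => ?_
        have := hsX (WithLp.toLp 2 fun j => ⟪negRightCoord m j, ξ⟫) x
        rw [gordonField, inner_rightForm]
        linarith

theorem sum_sq_entryRow_le (x : EuclideanSpace ℝ (Fin n))
    (G : EuclideanSpace ℝ (Fin m × Fin n)) :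
    ∑ i, ⟪entryRow x i, G⟫ ^ 2 ≤ (‖x‖ * ‖G‖) ^ 2 := by
  rw [mul_pow, EuclideanSpace.real_norm_sq_eq x, EuclideanSpace.real_norm_sq_eq G,
    Fintype.sum_prod_type, Finset.mul_sum]
  refine Finset.sum_le_sum fun i _ => ?_
  rw [inner_entryRow, mul_comm]
  exact Finset.sum_mul_sq_le_sq_mul_sq _ _ _

/-- **Gordon's escape theorem**: a Gaussian matrix has no kernel vector in a compact set of unit
vectors of small Gaussian width, up to small probability. -/
theorem measureReal_exists_kernel_le {K : Set (EuclideanSpace ℝ (Fin n))} (hK : IsCompact K)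
    (hK1 : ∀ x ∈ K, ‖x‖ = 1)
    {s : EuclideanSpace ℝ (Fin n) → ℝ} (hs : Integrable s (stdGaussian _))
    (hsK : ∀ g, ∀ x ∈ K, ⟪x, g⟫ ≤ s g)
    (hD : 0 < √((m : ℝ) - 1) - ∫ g, s g ∂(stdGaussian _) - 3) :
    (stdGaussian (EuclideanSpace ℝ (Fin m × Fin n))).real
        {G | ∃ x ∈ K, ∀ i, ⟪entryRow x i, G⟫ = 0} ≤
      2 / (√((m : ℝ) - 1) - ∫ g, s g ∂(stdGaussian _) - 3) ^ 2 := by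
  set D := √((m : ℝ) - 1) - ∫ g, s g ∂(stdGaussian _) - 3 with hDdef
  set μ := stdGaussian (EuclideanSpace ℝ (Fin m × Fin n)) with hμ
  rcases K.eq_empty_or_nonempty with rfl | hKne
  · simp
    positivity
  refine le_of_forall_pos_le_add fun η hη => ?_
  -- Since `‖G‖²` has mean `m n`, Markov gives `‖G‖ ≥ 1/δ` probability at most `η`.
  obtain ⟨δ, hδ, hδη⟩ : ∃ δ : ℝ, 0 < δ ∧ δ ^ 2 * (m * n) ≤ η := by
    refine ⟨√(η / (m * n + 1)), by positivity, ?_⟩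
    rw [Real.sq_sqrt (by positivity), div_mul_eq_mul_div, div_le_iff₀ (by positivity)]
    nlinarith
  obtain ⟨t, htK, htf, htc⟩ := hK.finite_cover_balls hδ
  have hcov : ∀ x ∈ K, ∃ y ∈ t, ‖x - y‖ < δ := fun x hx => by
    obtain ⟨y, hy, hxy⟩ := Set.mem_iUnion₂.1 (htc hx)
    exact ⟨y, hy, by rwa [Metric.mem_ball, dist_eq_norm] at hxy⟩
  have htne : Nonempty t := by
    obtain ⟨x, hx⟩ := hKne
    obtain ⟨y, hy, -⟩ := hcov x hx
    exact ⟨⟨y, hy⟩⟩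
  have := htf.fintype
  have hX : ∀ x : t, ‖(x : EuclideanSpace ℝ (Fin n))‖ = 1 := fun x => hK1 x (htK x.2)
  have hlog : 0 ≤ Real.log (Fintype.card t) := Real.log_natCast_nonneg _
  -- This keeps the smoothing loss below `1` whatever the net, so the size of the net never enters
  -- the final bound.
  set β : ℝ := 1 + Real.log (Fintype.card t) with hβdef
  have hβ : 0 < β := by positivity
  have hβlog : β⁻¹ * Real.log (Fintype.card t) ≤ 1 := by
    rw [inv_mul_le_iff₀ hβ]
    linarith
  obtain ⟨F, hF⟩ : ∃ F : EuclideanSpace ℝ (Fin m × Fin n) → ℝ, F =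
      fun G => softMin β (fun x : t => smoothNorm fun i : Fin m => ⟪entryRow x.1 i, G⟫) := ⟨_, rfl⟩
  have horth : ∀ x : t, Orthonormal ℝ (entryRow (m := m) x.1) := fun x =>
    orthonormal_entryRow (hX x)
  have hFmem : MemLp F 2 μ := hF ▸ memLp_softMin_smoothNorm hβ horth
  have hFvar : Var[F; μ] ≤ 2 := hF ▸ variance_softMin_smoothNorm_le hβ horth
  -- The `3` in `D` pays `1` for the smoothing loss and `2` for the value that a kernel vector
  -- forces at a nearby net point.
  have hFmean : D + 2 ≤ ∫ G, F G ∂μ := by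
    have := le_integral_softMin_matrix (m := m) hX hβ hs fun g x => hsK g x (htK x.2)
    rw [hF]
    linarith
  have hsub : {G : EuclideanSpace ℝ (Fin m × Fin n) | ∃ x ∈ K, ∀ i : Fin m, ⟪entryRow x i, G⟫ = 0} ⊆
      {G | D ≤ |F G - ∫ G, F G ∂μ|} ∪ {G | 1 / δ ^ 2 ≤ ‖G‖ ^ 2} := by
    rintro G ⟨x, hxK, hx⟩
    by_cases hG : 1 / δ ^ 2 ≤ ‖G‖ ^ 2
    · exact Or.inr hG
    left
    obtain ⟨y, hyt, hxy⟩ := hcov x hxK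
    have h1 : F G ≤ smoothNorm fun i : Fin m => ⟪entryRow y i, G⟫ := by
      rw [hF]
      exact softMin_le hβ _ (⟨y, hyt⟩ : t)
    have h2 : ∀ i : Fin m, ⟪entryRow y i, G⟫ ^ 2 = ⟪entryRow (x - y) i, G⟫ ^ 2 := fun i => by
      have h3 : ⟪entryRow (x - y) i, G⟫ = ⟪entryRow x i, G⟫ - ⟪entryRow y i, G⟫ := by
        simp only [inner_entryRow, ← Finset.sum_sub_distrib]
        exact Finset.sum_congr rfl fun j _ => by simp [mul_sub]
      rw [h3, hx, zero_sub, neg_sq]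
    -- If `G x = 0` then `‖G y‖ = ‖G (x - y)‖ ≤ 1`, so `F G ≤ 2`, a deviation of at least `D` below
    -- the mean.
    have h4 : (smoothNorm fun i : Fin m => ⟪entryRow y i, G⟫) ≤ 2 := by
      refine Real.sqrt_le_iff.2 ⟨by norm_num, ?_⟩
      simp only [h2]
      have h5 := sum_sq_entryRow_le (m := m) (x - y) G
      have h6 : (‖x - y‖ * ‖G‖) ^ 2 ≤ 1 := by
        rw [mul_pow]
        rw [not_le, lt_div_iff₀ (by positivity)] at hG
        have : ‖x - y‖ ^ 2 ≤ δ ^ 2 := by gcongr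
        nlinarith [sq_nonneg ‖G‖]
      linarith
    have h7 : F G - ∫ G, F G ∂μ ≤ -D := by linarith
    exact (le_neg.1 h7).trans (neg_le_abs _)
  have hcheb : μ.real {G | D ≤ |F G - ∫ G, F G ∂μ|} ≤ 2 / D ^ 2 := by
    have h1 := meas_ge_le_variance_div_sq hFmem hD
    rw [measureReal_def]
    refine ENNReal.toReal_le_of_le_ofReal (by positivity) (h1.trans (ENNReal.ofReal_le_ofReal ?_))
    gcongr
  have hmarkov : μ.real {G | 1 / δ ^ 2 ≤ ‖G‖ ^ 2} ≤ η := by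
    have h1 := mul_meas_ge_le_integral_of_nonneg (μ := μ)
      (ae_of_all _ fun G => sq_nonneg ‖G‖) integrable_norm_sq_stdGaussian (1 / δ ^ 2)
    rw [integral_norm_sq_stdGaussian, div_mul_eq_mul_div, one_mul, div_le_iff₀ (by positivity)] at h1
    refine h1.trans ?_
    simp only [finrank_euclideanSpace, Fintype.card_prod, Fintype.card_fin, Nat.cast_mul]
    linarith
  exact (measureReal_mono hsub).trans ((measureReal_union_le _ _).trans (add_le_add hcheb hmarkov))

end GordonEscape

/-! ### From Gaussian matrices to isotropically random orthogonal ones. -/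

section Isotropy

variable {m n : ℕ}

theorem isCompact_orthogonalGroup (n : ℕ) :
    IsCompact (Matrix.orthogonalGroup (Fin n) ℝ : Set (Matrix (Fin n) (Fin n) ℝ)) := by
  have hsub : (Matrix.orthogonalGroup (Fin n) ℝ : Set (Matrix (Fin n) (Fin n) ℝ)) ⊆
      Set.pi Set.univ fun _ : Fin n => Set.pi Set.univ fun _ : Fin n => Set.Icc (-1 : ℝ) 1 := by
    intro M hM i _ j _
    have := entry_norm_bound_of_unitary hM i j
    rwa [Real.norm_eq_abs, abs_le] at this
  have hc : IsCompact (Set.pi Set.univ fun _ : Fin n => Set.pi Set.univ fun _ : Fin n =>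
      Set.Icc (-1 : ℝ) 1) :=
    isCompact_univ_pi fun _ => isCompact_univ_pi fun _ => isCompact_Icc
  refine hc.of_isClosed_subset ?_ hsub
  have h : (Matrix.orthogonalGroup (Fin n) ℝ : Set (Matrix (Fin n) (Fin n) ℝ)) =
      {M | M * M.transpose = 1} := by
    ext M
    exact Matrix.mem_orthogonalGroup_iff _ _
  rw [h]
  exact isClosed_eq (by fun_prop) continuous_const

/-- Send an orthonormal basis of `N₁` into one of `N₂`, then extend the partial isometry to the
whole space. -/
theorem exists_linearIsometry_of_finrank_le {V : Type*} [NormedAddCommGroup V]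
    [InnerProductSpace ℝ V] [FiniteDimensional ℝ V] {N₁ N₂ : Submodule ℝ V}
    (h : Module.finrank ℝ N₁ ≤ Module.finrank ℝ N₂) :
    ∃ T : V →ₗᵢ[ℝ] V, ∀ x ∈ N₁, T x ∈ N₂ := by
  let b₁ := stdOrthonormalBasis ℝ N₁
  let b₂ := stdOrthonormalBasis ℝ N₂
  have hv : Orthonormal ℝ b₁.toBasis := by simp
  let L : N₁ →ₗᵢ[ℝ] N₂ := LinearMap.isometryOfOrthonormal
    (b₁.toBasis.constr ℝ (b₂ ∘ Fin.castLE h)) hv (by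
      have : (b₁.toBasis.constr ℝ (b₂ ∘ Fin.castLE h)) ∘ b₁.toBasis = b₂ ∘ Fin.castLE h := by
        ext i
        simp only [Function.comp_apply, Module.Basis.constr_basis]
      rw [this]
      exact b₂.orthonormal.comp _ (Fin.castLE_injective h))
  refine ⟨(N₂.subtypeₗᵢ.comp L).extend, fun x hx => ?_⟩
  have := (N₂.subtypeₗᵢ.comp L).extend_apply ⟨x, hx⟩
  simp only at this
  rw [this]
  exact (L ⟨x, hx⟩).2

theorem toEuclideanLin_symm_mem_orthogonalGroup
    (T : EuclideanSpace ℝ (Fin n) →ₗᵢ[ℝ] EuclideanSpace ℝ (Fin n)) :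
    Matrix.toEuclideanLin.symm T.toLinearMap ∈ Matrix.orthogonalGroup (Fin n) ℝ := by
  set M : Matrix (Fin n) (Fin n) ℝ := Matrix.toEuclideanLin.symm T.toLinearMap with hM
  have hMT : ∀ x, Matrix.toEuclideanLin M x = T x := fun x => by simp [hM]
  rw [Matrix.mem_orthogonalGroup_iff', ← Matrix.conjTranspose_eq_transpose_of_trivial]
  apply Matrix.toEuclideanLin.injective
  ext1 x
  refine ext_inner_left ℝ fun y => ?_
  have h1 : Matrix.toEuclideanLin (M.conjTranspose * M) x =
      Matrix.toEuclideanLin M.conjTranspose (Matrix.toEuclideanLin M x) := by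
    simp [Matrix.toLpLin_apply]
  rw [h1, Matrix.toEuclideanLin_conjTranspose_eq_adjoint, LinearMap.adjoint_inner_right, hMT, hMT,
    T.inner_map_map]
  simp

/-- If the rows of `a` are orthonormal, the kernel of `a` can be rotated into the kernel of any
other matrix of the same size. -/
theorem exists_orthogonal_kernel_le {a : Matrix (Fin m) (Fin n) ℝ} (ha : a * a.transpose = 1)
    (g : Matrix (Fin m) (Fin n) ℝ) :
    ∃ Θ ∈ Matrix.orthogonalGroup (Fin n) ℝ, ∀ x : Fin n → ℝ,
      a.mulVec x = 0 → (g * Θ).mulVec x = 0 := by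
  have hsurj : Function.Surjective (Matrix.toEuclideanLin a) := fun y =>
    ⟨Matrix.toEuclideanLin a.transpose y, by
      simp [Matrix.toLpLin_apply, ha]⟩
  -- By rank–nullity the surjective `a` has a kernel of dimension `n - m`, no larger than that of
  -- `g`.
  have h1 := LinearMap.finrank_range_add_finrank_ker (Matrix.toEuclideanLin a)
  have h2 := LinearMap.finrank_range_add_finrank_ker (Matrix.toEuclideanLin g)
  rw [LinearMap.range_eq_top.2 hsurj, finrank_top] at h1
  have h3 := Submodule.finrank_le (Matrix.toEuclideanLin g).range
  obtain ⟨T, hT⟩ := exists_linearIsometry_of_finrank_le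
    (N₁ := (Matrix.toEuclideanLin a).ker) (N₂ := (Matrix.toEuclideanLin g).ker) (by omega)
  refine ⟨_, toEuclideanLin_symm_mem_orthogonalGroup T, fun x hx => ?_⟩
  have h4 := hT (WithLp.toLp 2 x) (by simp [hx])
  have h5 : T (WithLp.toLp 2 x) =
      WithLp.toLp 2 ((Matrix.toEuclideanLin.symm T.toLinearMap).mulVec x) := by
    have h6 := Matrix.toLpLin_apply 2 2 (Matrix.toEuclideanLin.symm T.toLinearMap)
      (WithLp.toLp 2 x)
    rw [LinearEquiv.apply_symm_apply] at h6
    exact h6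
  rw [h5, LinearMap.mem_ker, Matrix.toLpLin_apply, Matrix.mulVec_mulVec] at h4
  simpa using congrArg (WithLp.ofLp) h4

/-- Matrices without kernel vector in `K`. -/
def kernelAvoiding (m : ℕ) (K : Set (EuclideanSpace ℝ (Fin n))) : Set (Fin m → Fin n → ℝ) :=
  {M | ∀ x ∈ K, Matrix.mulVec (Matrix.of M) x ≠ 0}

/-- The complement is the projection of a closed set along the compact `K`, hence closed. -/
theorem isOpen_kernelAvoiding {K : Set (EuclideanSpace ℝ (Fin n))} (hK : IsCompact K) :
    IsOpen (kernelAvoiding m K) := by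
  have hc : IsClosed {p : (Fin m → Fin n → ℝ) × K | Matrix.mulVec (Matrix.of p.1) p.2.1 = 0} := by
    refine isClosed_eq ?_ continuous_const
    refine Continuous.matrix_mulVec (by fun_prop) ?_
    fun_prop
  have := isCompact_iff_compactSpace.1 hK
  have h := isClosedMap_fst_of_compactSpace _ hc
  rw [← isClosed_compl_iff]
  convert h
  ext M
  simp [kernelAvoiding]

/-- Comparison of two random matrices of isotropic law, the first of which has orthonormal rows:
the first one is the most likely to have no kernel vector in `K`. -/
theorem measure_kernelAvoiding_le {K : Set (EuclideanSpace ℝ (Fin n))} (hK : IsCompact K)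
    {μ ν : Measure (Fin m → Fin n → ℝ)} [IsProbabilityMeasure μ] [IsProbabilityMeasure ν]
    (hμ : ∀ Θ ∈ Matrix.orthogonalGroup (Fin n) ℝ,
      μ.map (fun M i j => (Matrix.of M * Θ) i j) = μ)
    (hν : ∀ Θ ∈ Matrix.orthogonalGroup (Fin n) ℝ,
      ν.map (fun M i j => (Matrix.of M * Θ) i j) = ν)
    (hμ1 : ∀ᵐ M ∂μ, Matrix.of M * (Matrix.of M).transpose = 1) :
    ν (kernelAvoiding m K) ≤ μ (kernelAvoiding m K) := by
  let O := Matrix.orthogonalGroup (Fin n) ℝ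
  let _ : MeasurableSpace O := borel O
  have _ : BorelSpace O := ⟨rfl⟩
  have _ : CompactSpace O := isCompact_iff_compactSpace.1 (isCompact_orthogonalGroup n)
  have _ : SecondCountableTopology O :=
    (inferInstance : SecondCountableTopology {M : Fin n → Fin n → ℝ // M ∈
      (Matrix.orthogonalGroup (Fin n) ℝ : Set (Matrix (Fin n) (Fin n) ℝ))})
  let hr : Measure O := Measure.haarMeasure ⊤
  have _ : IsProbabilityMeasure hr := ⟨by
    have := Measure.haarMeasure_self (K₀ := (⊤ : TopologicalSpace.PositiveCompacts O))
    simpa using this⟩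
  have hU := isOpen_kernelAvoiding (m := m) hK
  have hmulc : Continuous fun p : (Fin m → Fin n → ℝ) × O =>
      (fun i j => (Matrix.of p.1 * (p.2 : Matrix (Fin n) (Fin n) ℝ)) i j) := by
    have : Continuous fun p : (Fin m → Fin n → ℝ) × O =>
      (Matrix.of p.1 * (p.2 : Matrix (Fin n) (Fin n) ℝ)) :=
      Continuous.matrix_mul (by fun_prop) (by fun_prop)
    exact this
  set S : Set ((Fin m → Fin n → ℝ) × O) := {p | (fun i j => (Matrix.of p.1 *
    (p.2 : Matrix (Fin n) (Fin n) ℝ)) i j) ∈ kernelAvoiding m K} with hS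
  have hSm : MeasurableSet S := (hU.preimage hmulc).measurableSet
  -- Invariance allows an independent Haar rotation on the right; Fubini then expresses the
  -- probability through the Haar measure of the rotations that keep a fixed matrix kernel-free on
  -- `K`.
  have key : ∀ κ : Measure (Fin m → Fin n → ℝ), IsProbabilityMeasure κ →
      (∀ Θ ∈ Matrix.orthogonalGroup (Fin n) ℝ,
        κ.map (fun M i j => (Matrix.of M * Θ) i j) = κ) →
      κ (kernelAvoiding m K) = ∫⁻ M, hr (Prod.mk M ⁻¹' S) ∂κ := by
    intro κ _ hκ
    rw [← Measure.prod_apply hSm, Measure.prod_apply_symm hSm]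
    have : ∀ Θ : O, κ ((fun M => (M, Θ)) ⁻¹' S) = κ (kernelAvoiding m K) := fun Θ => by
      conv_rhs => rw [← hκ Θ Θ.2]
      rw [Measure.map_apply _ hU.measurableSet]
      · rfl
      · exact (hmulc.comp (by fun_prop : Continuous fun M => (M, Θ))).measurable
    simp [this]
  -- With `Θ₀` carrying the kernel of `a` into that of `g`, whenever `g Θ₀ Θ` avoids `K` so does `a
  -- Θ`; left invariance of Haar measure absorbs `Θ₀`.
  have hcomp : ∀ᵐ a ∂μ, ∀ g, hr (Prod.mk g ⁻¹' S) ≤ hr (Prod.mk a ⁻¹' S) := by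
    filter_upwards [hμ1] with a ha g
    obtain ⟨Θ₀, hΘ₀, hker⟩ := exists_orthogonal_kernel_le ha (Matrix.of g)
    rw [← measure_preimage_mul hr (⟨Θ₀, hΘ₀⟩ : O)]
    refine measure_mono fun Θ hΘ x hx h0 => hΘ x hx ?_
    have h1 : Matrix.mulVec (Matrix.of a)
        (Matrix.mulVec (Θ : Matrix (Fin n) (Fin n) ℝ) x) = 0 := by
      rw [Matrix.mulVec_mulVec]
      exact h0
    have h2 := hker _ h1
    rw [Matrix.mulVec_mulVec, Matrix.mul_assoc] at h2
    exact h2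
  rw [key μ inferInstance hμ, key ν inferInstance hν]
  calc ∫⁻ g, hr (Prod.mk g ⁻¹' S) ∂ν
      = ∫⁻ _a, (∫⁻ g, hr (Prod.mk g ⁻¹' S) ∂ν) ∂μ := by simp
    _ ≤ _ := by
      refine lintegral_mono_ae ?_
      filter_upwards [hcomp] with a ha
      refine (lintegral_mono ha).trans ?_
      simp

open scoped RealInnerProductSpace

/-- The law of a matrix with independent standard normal entries. -/
noncomputable def gaussianMatrix (m n : ℕ) : Measure (Fin m → Fin n → ℝ) :=
  (stdGaussian (EuclideanSpace ℝ (Fin m × Fin n))).map fun G i j => G (i, j)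

theorem continuous_toMatrixFun :
    Continuous fun (G : EuclideanSpace ℝ (Fin m × Fin n)) (i : Fin m) (j : Fin n) => G (i, j) := by
  fun_prop

instance : IsProbabilityMeasure (gaussianMatrix m n) :=
  Measure.isProbabilityMeasure_map continuous_toMatrixFun.measurable.aemeasurable

/-- The entries of `G Θ` are the coordinates of `G` along another orthonormal system, built from the
columns of `Θ`. -/
theorem gaussianMatrix_map_mul {Θ : Matrix (Fin n) (Fin n) ℝ}
    (hΘ : Θ ∈ Matrix.orthogonalGroup (Fin n) ℝ) :
    (gaussianMatrix m n).map (fun M i j => (Matrix.of M * Θ) i j) = gaussianMatrix m n := by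
  have hmul : Continuous fun (M : Fin m → Fin n → ℝ) i j => (Matrix.of M * Θ) i j := by
    have : Continuous fun (M : Fin m → Fin n → ℝ) => Matrix.of M * Θ :=
      Continuous.matrix_mul (by fun_prop) (by fun_prop)
    exact this
  let v : Fin m × Fin n → EuclideanSpace ℝ (Fin m × Fin n) := fun p =>
    entryRow (WithLp.toLp 2 fun k => Θ k p.2) p.1
  have hv : Orthonormal ℝ v := by
    rw [orthonormal_iff_ite]
    rintro ⟨i, j⟩ ⟨i', j'⟩
    have h1 := congrFun (congrFun ((Matrix.mem_orthogonalGroup_iff' _ _).1 hΘ) j) j'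
    rw [Matrix.mul_apply, Matrix.one_apply] at h1
    simp only [v, inner_entryRow, Prod.mk.injEq]
    by_cases h : i = i'
    · simp only [entryRow, h, true_and]
      rw [← h1]
      simp [mul_comm]
    · simp [entryRow, h]
  conv_rhs => rw [gaussianMatrix, ← map_inner_orthonormal_stdGaussian hv]
  rw [gaussianMatrix, Measure.map_map hmul.measurable continuous_toMatrixFun.measurable,
    Measure.map_map continuous_toMatrixFun.measurable (Continuous.measurable (by fun_prop))]
  congr 1
  ext G i j
  simp [v, inner_entryRow, Matrix.mul_apply]

theorem gaussianMatrix_kernelAvoiding {K : Set (EuclideanSpace ℝ (Fin n))} (hK : IsCompact K) :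
    gaussianMatrix m n (kernelAvoiding m K) =
      stdGaussian (EuclideanSpace ℝ (Fin m × Fin n))
        {G | ∃ x ∈ K, ∀ i, ⟪entryRow x i, G⟫ = 0}ᶜ := by
  rw [gaussianMatrix, Measure.map_apply continuous_toMatrixFun.measurable
    (isOpen_kernelAvoiding hK).measurableSet]
  congr 1
  ext G
  simp [kernelAvoiding, inner_entryRow, funext_iff, Matrix.mulVec, dotProduct]

/-- Among matrices of isotropic law, those with orthonormal rows are at least as likely as Gaussian
matrices to have no kernel vector in a compact set. -/
theorem IsIRO.measure_kernelAvoiding_ge {Ω : Type*} [MeasurableSpace Ω] {P : Measure Ω}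
    [IsProbabilityMeasure P] {A : Ω → Matrix (Fin m) (Fin n) ℝ} (hA : IsIRO P A)
    {K : Set (EuclideanSpace ℝ (Fin n))} (hK : IsCompact K) :
    gaussianMatrix m n (kernelAvoiding m K) ≤
      P {w | A w * (A w).transpose = 1 ∧ ∀ x ∈ K, (A w).mulVec x ≠ 0} := by
  have hAm : AEMeasurable (fun w (i : Fin m) (j : Fin n) => A w i j) P :=
    aemeasurable_pi_lambda _ fun i => aemeasurable_pi_lambda _ fun j => hA.aemeasurable_entry i j
  have _ := Measure.isProbabilityMeasure_map hAm
  have hmeas1 : MeasurableSet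
      {M : Fin m → Fin n → ℝ | Matrix.of M * (Matrix.of M).transpose = 1} := by
    refine (isClosed_eq ?_ continuous_const).measurableSet
    exact Continuous.matrix_mul (by fun_prop) (Continuous.matrix_transpose (by fun_prop))
  have h := measure_kernelAvoiding_le hK (μ := P.map fun w i j => A w i j)
    (ν := gaussianMatrix m n) ?_ (fun Θ hΘ => gaussianMatrix_map_mul hΘ) ?_
  · refine h.trans ?_
    rw [Measure.map_apply_of_aemeasurable hAm (isOpen_kernelAvoiding hK).measurableSet]
    refine measure_mono_ae ?_
    filter_upwards [hA.orthonormal_rows] with w hw hK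
    exact ⟨hw, hK⟩
  · intro Θ hΘ
    have h1 := hA.law_invariant 1 (one_mem _) Θ hΘ
    have hmul : Continuous fun (M : Fin m → Fin n → ℝ) i j => (Matrix.of M * Θ) i j := by
      have : Continuous fun (M : Fin m → Fin n → ℝ) => Matrix.of M * Θ :=
        Continuous.matrix_mul (by fun_prop) (by fun_prop)
      exact this
    rw [AEMeasurable.map_map_of_aemeasurable hmul.measurable.aemeasurable hAm]
    refine (congrArg (P.map ·) ?_).trans h1
    ext w i j
    exact congrFun (congrFun (congrArg (· * Θ) (Matrix.one_mul (A w)).symm) i) j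
  · exact (ae_map_iff hAm hmeas1).2 hA.orthonormal_rows

end Isotropy

/-! ### Angular tubes: their Gaussian width and the conic singular value. -/

section ConicWidth

open scoped RealInnerProductSpace

variable {m n : ℕ}

/-- The unit vectors of a set. -/
def unitPart (T : Set (EuclideanSpace ℝ (Fin n))) : Set (EuclideanSpace ℝ (Fin n)) :=
  {w | w ∈ T ∧ ‖w‖ = 1}

/-- The support function of the unit vectors of a set. -/
noncomputable def unitSupport (T : Set (EuclideanSpace ℝ (Fin n)))
    (g : EuclideanSpace ℝ (Fin n)) : ℝ :=
  sSup ((fun w => ⟪g, w⟫) '' unitPart T)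

/-- The unit vectors at angle at most `θ` from a unit vector of `T`. -/
noncomputable def angularTube (T : Set (EuclideanSpace ℝ (Fin n))) (θ : ℝ) :
    Set (EuclideanSpace ℝ (Fin n)) :=
  {x | ‖x‖ = 1 ∧ ∃ t ∈ unitPart T, Real.cos θ ≤ ⟪x, t⟫}

variable {T : Set (EuclideanSpace ℝ (Fin n))}

theorem inner_le_unitSupport {t : EuclideanSpace ℝ (Fin n)} (ht : t ∈ unitPart T)
    (g : EuclideanSpace ℝ (Fin n)) : ⟪g, t⟫ ≤ unitSupport T g := by
  refine le_csSup ⟨‖g‖, ?_⟩ (Set.mem_image_of_mem _ ht)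
  rintro _ ⟨w, hw, rfl⟩
  simpa [hw.2] using real_inner_le_norm g w

theorem unitSupport_le (hT : (unitPart T).Nonempty) {g : EuclideanSpace ℝ (Fin n)} {c : ℝ}
    (h : ∀ t ∈ unitPart T, ⟪g, t⟫ ≤ c) : unitSupport T g ≤ c := by
  refine csSup_le (hT.image _) ?_
  rintro _ ⟨w, hw, rfl⟩
  exact h w hw

theorem lipschitzWith_unitSupport (hT : (unitPart T).Nonempty) :
    LipschitzWith 1 (unitSupport T) := by
  refine LipschitzWith.of_le_add fun g g' => unitSupport_le hT fun t ht => ?_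
  have h1 := inner_le_unitSupport ht g'
  have h2 := real_inner_le_norm (g - g') t
  rw [inner_sub_left, ht.2, mul_one, ← dist_eq_norm] at h2
  linarith

theorem integrable_unitSupport (hT : (unitPart T).Nonempty) :
    Integrable (unitSupport T) (stdGaussian _) := by
  obtain ⟨t, ht⟩ := hT
  refine integrable_norm_stdGaussian.mono'
    (lipschitzWith_unitSupport ⟨t, ht⟩).continuous.aestronglyMeasurable (ae_of_all _ fun g => ?_)
  rw [Real.norm_eq_abs, abs_le]
  constructor
  · refine le_trans ?_ (inner_le_unitSupport ht g)
    have := abs_real_inner_le_norm g t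
    rw [ht.2, mul_one] at this
    exact (abs_le.1 this).1
  · refine unitSupport_le ⟨t, ht⟩ fun w hw => ?_
    simpa [hw.2] using real_inner_le_norm g w

theorem gaussianWidth_eq (T : Set (EuclideanSpace ℝ (Fin n))) :
    gaussianWidth T = ∫ g, unitSupport T g ∂(stdGaussian _) := rfl

theorem gaussianWidth_nonneg (hT : (unitPart T).Nonempty) : 0 ≤ gaussianWidth T := by
  obtain ⟨t, ht⟩ := hT
  have h := integral_strongDual_stdGaussian (innerSL ℝ t)
  rw [gaussianWidth_eq, ← h]
  refine integral_mono ((innerSL ℝ t).integrable_comp IsGaussian.integrable_id)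
    (integrable_unitSupport ⟨t, ht⟩) fun g => ?_
  simpa [real_inner_comm] using inner_le_unitSupport ht g

theorem isCompact_unitPart (hT : IsClosed T) : IsCompact (unitPart T) := by
  have : unitPart T = Metric.sphere 0 1 ∩ T := by
    ext w
    simp [unitPart, and_comm]
  rw [this]
  exact (isCompact_sphere 0 1).inter_right hT

theorem isCompact_angularTube (hT : IsClosed T) (θ : ℝ) : IsCompact (angularTube T θ) := by
  have h : angularTube T θ = Prod.fst '' ((Metric.sphere (0 : EuclideanSpace ℝ (Fin n)) 1 ×ˢ
      unitPart T) ∩ {p | Real.cos θ ≤ ⟪p.1, p.2⟫}) := by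
    ext x
    simp [angularTube, and_assoc]
  rw [h]
  refine IsCompact.image (IsCompact.inter_right ((isCompact_sphere 0 1).prod
    (isCompact_unitPart hT)) ?_) continuous_fst
  exact isClosed_le continuous_const (by fun_prop)

/-- The support function of an angular tube is controlled by the support function of the cone. -/
theorem inner_le_of_mem_angularTube {α θ : ℝ} (hα : 0 ≤ α) (hα' : α < Real.pi / 2) (hθ : 0 ≤ θ)
    (hαθ : α + θ ≤ Real.pi / 2) {x : EuclideanSpace ℝ (Fin n)} (hx : x ∈ angularTube T θ)
    (g : EuclideanSpace ℝ (Fin n)) :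
    ⟪x, g⟫ ≤ (Real.cos α)⁻¹ * (Real.cos (α + θ) * unitSupport T g + Real.sin θ * ‖g‖) := by
  obtain ⟨hx1, t, ht, hxt⟩ := hx
  have hcα : 0 < Real.cos α := Real.cos_pos_of_mem_Ioo ⟨by linarith, hα'⟩
  have hcαθ : 0 ≤ Real.cos (α + θ) := Real.cos_nonneg_of_mem_Icc ⟨by linarith, hαθ⟩
  have hsθ : 0 ≤ Real.sin θ := Real.sin_nonneg_of_nonneg_of_le_pi hθ (by linarith)
  -- The coefficients make the remainder have norm exactly `sin θ` when `x` and `t` are at angle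
  -- `θ`; a smaller angle only shortens it.
  have h1 : ‖Real.cos α • x - Real.cos (α + θ) • t‖ ≤ Real.sin θ := by
    refine abs_le_of_sq_le_sq' ?_ hsθ |>.2
    rw [norm_sub_sq_real, norm_smul, norm_smul, hx1, ht.2, inner_smul_left, inner_smul_right]
    simp only [Real.norm_eq_abs, mul_one, sq_abs, conj_trivial]
    have h2 : Real.cos α * (Real.cos (α + θ) * Real.cos θ) ≤
        Real.cos α * (Real.cos (α + θ) * ⟪x, t⟫) := by gcongr
    have h3 : Real.cos α ^ 2 - 2 * (Real.cos α * (Real.cos (α + θ) * Real.cos θ)) +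
        Real.cos (α + θ) ^ 2 = Real.sin θ ^ 2 := by
      rw [Real.cos_add, Real.sin_sq θ]
      have e1 := Real.sin_sq_add_cos_sq α
      have e2 := Real.sin_sq_add_cos_sq θ
      have e3 : Real.sin α ^ 2 = 1 - Real.cos α ^ 2 := by linarith
      have e4 : Real.sin θ ^ 2 = 1 - Real.cos θ ^ 2 := by linarith
      linear_combination Real.sin θ ^ 2 * e3 + e4 - Real.cos α ^ 2 * e2
    linarith
  have h4 := real_inner_le_norm (Real.cos α • x - Real.cos (α + θ) • t) g
  have h5 := mul_le_mul_of_nonneg_right h1 (norm_nonneg g)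
  have h6 := mul_le_mul_of_nonneg_left (inner_le_unitSupport ht g) hcαθ
  rw [inner_sub_left, inner_smul_left, inner_smul_left, real_inner_comm g t] at h4
  simp only [conj_trivial] at h4
  rw [← div_eq_inv_mul, le_div_iff₀ hcα]
  linarith

theorem integral_norm_stdGaussian_le :
    ∫ g, ‖g‖ ∂(stdGaussian (EuclideanSpace ℝ (Fin n))) ≤ √(n : ℝ) := by
  refine Real.le_sqrt_of_sq_le ?_
  have hmem : MemLp (fun g : EuclideanSpace ℝ (Fin n) => ‖g‖) 2 (stdGaussian _) :=
    (IsGaussian.memLp_two_id (μ := stdGaussian (EuclideanSpace ℝ (Fin n)))).norm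
  have h := variance_eq_sub hmem
  have h0 := variance_nonneg (fun g : EuclideanSpace ℝ (Fin n) => ‖g‖) (stdGaussian _)
  have h1 := integral_norm_sq_stdGaussian (E := EuclideanSpace ℝ (Fin n))
  rw [finrank_euclideanSpace_fin] at h1
  simp only [Pi.pow_apply] at h
  linarith

/-- If no kernel vector of a matrix with orthonormal rows lies in the angular tube of opening `θ`
around `T`, then the minimum conic singular value is at least `sin θ`. -/
theorem sin_le_minConicSingularValue {a : Matrix (Fin m) (Fin n) ℝ} (ha : a * a.transpose = 1)
    (hT : (unitPart T).Nonempty) {θ : ℝ} (hθ : 0 ≤ θ) (hθ' : θ < Real.pi / 2)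
    (hker : ∀ x ∈ angularTube T θ, a.mulVec x ≠ 0) :
    Real.sin θ ≤ minConicSingularValue a T := by
  refine le_csInf (hT.image _) ?_
  rintro _ ⟨t, ht, rfl⟩
  by_contra! hlt
  have hcθ : 0 < Real.cos θ := Real.cos_pos_of_mem_Ioo ⟨by linarith, hθ'⟩
  set y := Matrix.toEuclideanLin a t with hy
  -- `p` is the orthogonal projection of `t` onto the kernel. Normalized, it makes with `t` an angle
  -- of cosine `‖p‖ ≥ cos θ`, so it is a kernel vector in the tube.
  set p := t - Matrix.toEuclideanLin a.transpose y with hp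
  have hadj : ∀ z : EuclideanSpace ℝ (Fin n),
      ⟪Matrix.toEuclideanLin a.transpose y, z⟫ = ⟪y, Matrix.toEuclideanLin a z⟫ := fun z => by
    rw [← Matrix.conjTranspose_eq_transpose_of_trivial,
      Matrix.toEuclideanLin_conjTranspose_eq_adjoint, LinearMap.adjoint_inner_left]
  have haa : Matrix.toEuclideanLin a (Matrix.toEuclideanLin a.transpose y) = y := by
    simp [Matrix.toLpLin_apply, ha]
  have hap : Matrix.toEuclideanLin a p = 0 := by
    rw [hp, map_sub, haa, ← hy, sub_self]
  have hpt : ⟪p, t⟫ = 1 - ‖y‖ ^ 2 := by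
    rw [hp, inner_sub_left, hadj, ← hy, real_inner_self_eq_norm_sq, real_inner_self_eq_norm_sq,
      ht.2]
    norm_num
  have hpp : ‖p‖ ^ 2 = 1 - ‖y‖ ^ 2 := by
    rw [← hpt, ← real_inner_self_eq_norm_sq]
    conv_lhs => rw [hp]
    rw [inner_sub_left, hadj, hap, inner_zero_right, sub_zero, real_inner_comm]
  have hcos : Real.cos θ ^ 2 ≤ ‖p‖ ^ 2 := by
    rw [hpp, Real.cos_sq']
    gcongr
  have hcos' : Real.cos θ ≤ ‖p‖ := (sq_le_sq₀ hcθ.le (norm_nonneg _)).1 hcos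
  have hp0 : 0 < ‖p‖ := hcθ.trans_le hcos'
  refine hker (‖p‖⁻¹ • p) ⟨?_, t, ht, ?_⟩ ?_
  · rw [norm_smul, norm_inv, norm_norm, inv_mul_cancel₀ hp0.ne']
  · rw [inner_smul_left, hpt, ← hpp]
    simp only [conj_trivial]
    rwa [pow_two, inv_mul_cancel_left₀ hp0.ne']
  · have h1 : Matrix.toEuclideanLin a (‖p‖⁻¹ • p) = 0 := by rw [map_smul, hap, smul_zero]
    rw [Matrix.toLpLin_apply] at h1
    simpa using congrArg WithLp.ofLp h1

theorem minConicSingularValue_nonneg (a : Matrix (Fin m) (Fin n) ℝ)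
    (T : Set (EuclideanSpace ℝ (Fin n))) : 0 ≤ minConicSingularValue a T := by
  refine Real.sInf_nonneg ?_
  rintro _ ⟨t, -, rfl⟩
  exact norm_nonneg _

/-- Non-asymptotic lower bound for the minimum conic singular value of an isotropically random
orthogonal matrix, in terms of the angle `α` that represents the Gaussian width of the cone. -/
theorem IsIRO.measure_minConicSingularValue_ge {Ω : Type*} [MeasurableSpace Ω] {P : Measure Ω}
    [IsProbabilityMeasure P] {A : Ω → Matrix (Fin m) (Fin n) ℝ} (hA : IsIRO P A)
    (hTc : IsClosed T) (hT : (unitPart T).Nonempty) {α θ : ℝ} (hα : 0 ≤ α)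
    (hα' : α < Real.pi / 2) (hθ : 0 ≤ θ) (hαθ : α + θ < Real.pi / 2)
    (hω : gaussianWidth T = √(n : ℝ) * Real.sin α)
    (hD : 0 < √((m : ℝ) - 1) - √(n : ℝ) * Real.sin (α + θ) - 3) :
    1 - ENNReal.ofReal (2 / (√((m : ℝ) - 1) - √(n : ℝ) * Real.sin (α + θ) - 3) ^ 2) ≤
      P {w | Real.sin θ ≤ minConicSingularValue (A w) T} := by
  have hcα : 0 < Real.cos α := Real.cos_pos_of_mem_Ioo ⟨by linarith, hα'⟩
  have hsθ : 0 ≤ Real.sin θ := Real.sin_nonneg_of_nonneg_of_le_pi hθ (by linarith)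
  have hK := isCompact_angularTube hTc θ
  set s : EuclideanSpace ℝ (Fin n) → ℝ := fun g =>
    (Real.cos α)⁻¹ * (Real.cos (α + θ) * unitSupport T g + Real.sin θ * ‖g‖) with hs
  have hs1 : Integrable (fun g => Real.cos (α + θ) * unitSupport T g) (stdGaussian _) :=
    (integrable_unitSupport hT).const_mul _
  have hs2 : Integrable (fun g : EuclideanSpace ℝ (Fin n) => Real.sin θ * ‖g‖) (stdGaussian _) :=
    integrable_norm_stdGaussian.const_mul _
  have hsi : Integrable s (stdGaussian _) := (hs1.add hs2).const_mul _
  have hsint : ∫ g, s g ∂(stdGaussian _) ≤ √(n : ℝ) * Real.sin (α + θ) := by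
    simp only [hs]
    rw [integral_const_mul, integral_add hs1 hs2, integral_const_mul, integral_const_mul,
      ← gaussianWidth_eq, hω, ← div_eq_inv_mul, div_le_iff₀ hcα]
    have h1 := mul_le_mul_of_nonneg_left (integral_norm_stdGaussian_le (n := n)) hsθ
    -- This is `sin θ = sin ((α + θ) - α)`: the coefficients chosen for the tube make the width
    -- bound collapse to `√n sin (α + θ)`.
    have h2 : Real.cos (α + θ) * (√(n : ℝ) * Real.sin α) + Real.sin θ * √(n : ℝ) =
        √(n : ℝ) * Real.sin (α + θ) * Real.cos α := by
      rw [Real.cos_add, Real.sin_add]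
      linear_combination -(√(n : ℝ) * Real.sin θ) * (Real.sin_sq_add_cos_sq α)
    linarith
  set D := √((m : ℝ) - 1) - √(n : ℝ) * Real.sin (α + θ) - 3 with hDdef
  set D' := √((m : ℝ) - 1) - ∫ g, s g ∂(stdGaussian _) - 3 with hD'
  have hDD' : D ≤ D' := by linarith
  have hesc := measureReal_exists_kernel_le (m := m) hK (fun x hx => hx.1) hsi
    (fun g x hx => inner_le_of_mem_angularTube hα hα' hθ hαθ.le hx g) (hD.trans_le hDD')
  have h1 := hA.measure_kernelAvoiding_ge hK
  rw [gaussianMatrix_kernelAvoiding hK] at h1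
  refine le_trans ?_ (h1.trans (measure_mono fun w hw =>
    sin_le_minConicSingularValue hw.1 hT hθ (by linarith) hw.2))
  rw [tsub_le_iff_right]
  have h2 := measure_univ_le_add_compl (μ := stdGaussian (EuclideanSpace ℝ (Fin m × Fin n)))
    {G | ∃ x ∈ angularTube T θ, ∀ i, ⟪entryRow x i, G⟫ = 0}
  rw [measure_univ, add_comm] at h2
  refine h2.trans (add_le_add le_rfl ?_)
  rw [← ofReal_measureReal]
  refine ENNReal.ofReal_le_ofReal (hesc.trans ?_)
  gcongr

end ConicWidth

/-! ### Trigonometric form of the bound and its limit. -/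

section Asymptotics

/-- The conic bound is the sine of the difference of the two angles that represent the number of
rows and the Gaussian width. -/
theorem conicBound_eq_sin {m n : ℕ} {ω α β : ℝ} (hmn : m < n) (hωm : ω ^ 2 < m)
    (hα : α ∈ Set.Icc 0 (Real.pi / 2)) (hβ : β ∈ Set.Icc 0 (Real.pi / 2))
    (hsα : ω = √(n : ℝ) * Real.sin α) (hsβ : √(m : ℝ) = √(n : ℝ) * Real.sin β) :
    conicBound m n ω = Real.sin (β - α) := by
  have hmn' : (m : ℝ) < n := by exact_mod_cast hmn
  have hm0 : (0 : ℝ) ≤ m := Nat.cast_nonneg m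
  have hn0 : (0 : ℝ) < n := hm0.trans_lt hmn'
  obtain ⟨q, hq⟩ : ∃ q, q = √(n : ℝ) := ⟨_, rfl⟩
  have hq0 : 0 < q := hq ▸ Real.sqrt_pos.2 hn0
  have hq2 : (n : ℝ) = q ^ 2 := by rw [hq, Real.sq_sqrt hn0.le]
  rw [← hq] at hsα hsβ
  have hcα : 0 ≤ Real.cos α := Real.cos_nonneg_of_mem_Icc ⟨by linarith [hα.1, Real.pi_pos], hα.2⟩
  have hcβ : 0 ≤ Real.cos β := Real.cos_nonneg_of_mem_Icc ⟨by linarith [hβ.1, Real.pi_pos], hβ.2⟩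
  have hm2 : (m : ℝ) = (q * Real.sin β) ^ 2 := by rw [← hsβ, Real.sq_sqrt hm0]
  have h1 : √((n : ℝ) - ω ^ 2) = q * Real.cos α := by
    rw [Real.sqrt_eq_iff_mul_self_eq (by linarith) (by positivity), hq2, hsα]
    linear_combination -q ^ 2 * Real.sin_sq_add_cos_sq α
  have h2 : √((n : ℝ) - m) = q * Real.cos β := by
    rw [Real.sqrt_eq_iff_mul_self_eq (by linarith) (by positivity), hq2, hm2]
    linear_combination -q ^ 2 * Real.sin_sq_add_cos_sq β
  have hcβ' : 0 < Real.cos β := by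
    have : 0 < √((n : ℝ) - m) := Real.sqrt_pos.2 (by linarith)
    rw [h2] at this
    exact pos_of_mul_pos_right this hq0.le
  have hsαβ : Real.sin α < Real.sin β := by
    rw [hm2, hsα] at hωm
    have hsβ0 : 0 ≤ Real.sin β :=
      Real.sin_nonneg_of_nonneg_of_le_pi hβ.1 (by linarith [hβ.2, Real.pi_pos])
    exact lt_of_mul_lt_mul_left (lt_of_pow_lt_pow_left₀ 2 (by positivity) hωm) hq0.le
  have hαβ : α < β := by
    by_contra! h
    have := Real.sin_le_sin_of_le_of_le_pi_div_two (by linarith [hβ.1, Real.pi_pos]) hα.2 h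
    linarith
  have hcα' : 0 < Real.cos α := Real.cos_pos_of_mem_Ioo
    ⟨by linarith [hα.1, Real.pi_pos], by linarith [hβ.2]⟩
  have hsβα : 0 < Real.sin (β - α) :=
    Real.sin_pos_of_pos_of_lt_pi (by linarith) (by linarith [hα.1, hβ.2, Real.pi_pos])
  have hsβ0 : 0 < Real.sin β := Real.sin_pos_of_pos_of_lt_pi (by linarith [hα.1])
    (by linarith [hβ.2, Real.pi_pos])
  have hchi : chi m n ω = Real.sin (β - α) / (q * Real.cos β) := by
    rw [chi, h1, h2, hsβ, hsα, hq2, Real.sin_sub]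
    field_simp
  set c := Real.cos β with hc
  set S := Real.sin (β - α) with hS
  have hchi0 : 0 < S / (q * c) := by positivity
  have e1 := Real.sin_sq_add_cos_sq α
  have e2 := Real.sin_sq_add_cos_sq β
  have hSdef : S = Real.sin β * Real.cos α - c * Real.sin α := Real.sin_sub β α
  have hρ : rho m n ω = q ^ 2 * (Real.sin α * c / S + c ^ 2) := by
    rw [rho, hchi, hsα, hm2, hq2]
    field_simp
    linear_combination -S * e2
  -- Denominator and numerator share the factor `q² sin β cos α`, divided by `S` in one and
  -- multiplied by `S` in the other; the quotient is `S²`.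
  have hmρ : (m : ℝ) + rho m n ω = q ^ 2 * (Real.sin β * Real.cos α / S) := by
    rw [hρ, hm2]
    field_simp
    rw [hSdef]
    linear_combination (Real.sin β * Real.cos α - c * Real.sin α) * e2
  have hnum : (m : ℝ) + rho m n ω ^ 2 * chi m n ω ^ 2 - 2 * rho m n ω * chi m n ω * ω
      - rho m n ω * chi m n ω ^ 2 * ((n : ℝ) - m) = q ^ 2 * (Real.sin β * Real.cos α * S) := by
    have hN : (n : ℝ) - m = q ^ 2 * c ^ 2 := by
      rw [hm2, hq2]
      linear_combination -q ^ 2 * e2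
    have hρχ : rho m n ω * chi m n ω = q * (Real.sin α + c * S) := by
      rw [hρ, hchi]
      field_simp
    have hχ : chi m n ω * ((n : ℝ) - m) = q * c * S := by
      rw [hN, hchi]
      field_simp
    calc _ = (m : ℝ) + (rho m n ω * chi m n ω) ^ 2 - 2 * (rho m n ω * chi m n ω) * ω
          - (rho m n ω * chi m n ω) * (chi m n ω * ((n : ℝ) - m)) := by ring
      _ = _ := by
        rw [hρχ, hχ, hm2, hsα]
        linear_combination q ^ 2 * (-Real.sin β ^ 2 * e1 + Real.sin α ^ 2 * e2 -
          (Real.sin β * Real.cos α + c * Real.sin α) * hSdef)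
  rw [conicBound, hnum, hmρ]
  have : q ^ 2 * (Real.sin β * Real.cos α * S) / (q ^ 2 * (Real.sin β * Real.cos α / S)) =
      S ^ 2 := by
    field_simp
  rw [this, Real.sqrt_sq hsβα.le]

/-- Both sides are `2 sin ((β - α)/2)` times a cosine, of `(β + α)/2` on the left and of the smaller
`(β - α)/2` on the right. -/
theorem sin_sub_sin_lt_sin_sub {α β : ℝ} (hα : 0 < α) (hαβ : α < β) (hβ : β < Real.pi) :
    Real.sin β - Real.sin α < Real.sin (β - α) := by
  have h1 : Real.sin β - Real.sin α = 2 * Real.sin ((β - α) / 2) * Real.cos ((β + α) / 2) :=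
    Real.sin_sub_sin β α
  have h2 : Real.sin (β - α) = 2 * Real.sin ((β - α) / 2) * Real.cos ((β - α) / 2) := by
    rw [← Real.sin_two_mul]
    ring_nf
  rw [h1, h2]
  have h3 : 0 < Real.sin ((β - α) / 2) :=
    Real.sin_pos_of_pos_of_lt_pi (by linarith) (by linarith)
  have h4 : Real.cos ((β + α) / 2) < Real.cos ((β - α) / 2) :=
    Real.cos_lt_cos_of_nonneg_of_le_pi (by linarith) (by linarith) (by linarith)
  gcongr

/-- The escape margin, per unit of `√n`, gained by giving up an angle `τ`; it is uniform as long as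
`cos β` is bounded below. -/
theorem two_mul_sin_mul_cos_le {β τ : ℝ} (hτ : 0 ≤ τ) (hτβ : τ ≤ β) (hβ : β ≤ Real.pi / 2) :
    2 * Real.sin (τ / 2) * Real.cos β ≤ Real.sin β - Real.sin (β - τ) := by
  have h1 : Real.sin β - Real.sin (β - τ) = 2 * Real.sin (τ / 2) * Real.cos (β - τ / 2) := by
    rw [Real.sin_sub_sin]
    ring_nf
  rw [h1]
  have h2 : 0 ≤ Real.sin (τ / 2) :=
    Real.sin_nonneg_of_nonneg_of_le_pi (by linarith) (by linarith [Real.pi_pos])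
  have h3 : Real.cos β ≤ Real.cos (β - τ / 2) :=
    Real.cos_le_cos_of_nonneg_of_le_pi (by linarith) (by linarith [Real.pi_pos]) (by linarith)
  gcongr

theorem exists_angles {m n : ℕ} {ω : ℝ} (hmn : m < n) (hω0 : 0 ≤ ω) (hωm : ω ^ 2 < m) :
    ∃ α β : ℝ, 0 ≤ α ∧ α < β ∧ β < Real.pi / 2 ∧ ω = √(n : ℝ) * Real.sin α ∧
      √(m : ℝ) = √(n : ℝ) * Real.sin β ∧ Real.cos β = √(1 - (m : ℝ) / n) := by
  have hmn' : (m : ℝ) < n := by exact_mod_cast hmn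
  have hm0 : (0 : ℝ) ≤ m := Nat.cast_nonneg m
  have hn0 : (0 : ℝ) < n := hm0.trans_lt hmn'
  have hq : 0 < √(n : ℝ) := Real.sqrt_pos.2 hn0
  have hωlt : ω < √(m : ℝ) := Real.lt_sqrt_of_sq_lt hωm
  have hlt : √(m : ℝ) < √(n : ℝ) := Real.sqrt_lt_sqrt hm0 hmn'
  have h1 : ω / √(n : ℝ) < √(m : ℝ) / √(n : ℝ) := by gcongr
  have h2 : √(m : ℝ) / √(n : ℝ) < 1 := (div_lt_one hq).2 hlt
  have h3 : 0 ≤ ω / √(n : ℝ) := by positivity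
  refine ⟨Real.arcsin (ω / √(n : ℝ)), Real.arcsin (√(m : ℝ) / √(n : ℝ)),
    Real.arcsin_nonneg.2 h3, ?_, Real.arcsin_lt_pi_div_two.2 h2, ?_, ?_, ?_⟩
  · exact Real.strictMonoOn_arcsin ⟨by linarith, by linarith⟩ ⟨by linarith, by linarith⟩ h1
  · rw [Real.sin_arcsin (by linarith) (by linarith), mul_div_cancel₀ _ hq.ne']
  · rw [Real.sin_arcsin (by linarith) (by linarith), mul_div_cancel₀ _ hq.ne']
  · rw [Real.cos_arcsin, div_pow, Real.sq_sqrt hm0, Real.sq_sqrt hn0.le]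

/-- Non-asymptotic form of the lower bound for the minimum conic singular value. -/
theorem IsIRO.measure_conicBound_sub_le {Ω : Type*} [MeasurableSpace Ω] {P : Measure Ω}
    [IsProbabilityMeasure P] {m n : ℕ} {A : Ω → Matrix (Fin m) (Fin n) ℝ} (hA : IsIRO P A)
    {T : Set (EuclideanSpace ℝ (Fin n))} (hTc : IsClosed T) (hT : (unitPart T).Nonempty)
    (hmn : m < n) (hωm : gaussianWidth T ^ 2 < m) {ζ τ c : ℝ} (hτ : 0 < τ) (hτζ : τ ≤ ζ)
    (hc : c ≤ 2 * Real.sin (τ / 2) * √(1 - (m : ℝ) / n)) (hcn : 4 < c * √(n : ℝ)) :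
    1 - ENNReal.ofReal (2 / (c * √(n : ℝ) - 4) ^ 2) ≤
      P {w | conicBound m n (gaussianWidth T) - ζ ≤ minConicSingularValue (A w) T} := by
  obtain ⟨α, β, hα, hαβ, hβ, hsα, hsβ, hcβ⟩ := exists_angles hmn (gaussianWidth_nonneg hT) hωm
  rw [conicBound_eq_sin hmn hωm ⟨hα, by linarith⟩ ⟨by linarith, hβ.le⟩ hsα hsβ]
  -- When the gap is below `τ`, the claimed bound is at most `τ - ζ ≤ 0` and holds trivially;
  -- otherwise `θ = β - α - τ` is an admissible opening.
  rcases lt_or_ge (β - α) τ with hlt | hge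
  · have huniv : {w | Real.sin (β - α) - ζ ≤ minConicSingularValue (A w) T} = Set.univ := by
      refine Set.eq_univ_of_forall fun w => le_trans ?_ (minConicSingularValue_nonneg (A w) T)
      have := Real.sin_le (x := β - α) (by linarith)
      linarith
    rw [huniv, measure_univ]
    exact tsub_le_self
  have hsin : Real.sin (β - α) - ζ ≤ Real.sin (β - α - τ) := by
    have h1 := Real.lipschitzWith_sin.dist_le_mul (β - α) (β - α - τ)
    simp only [Real.dist_eq, NNReal.coe_one, one_mul, sub_sub_cancel, abs_of_pos hτ] at h1
    linarith [le_abs_self (Real.sin (β - α) - Real.sin (β - α - τ))]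
  have hq : 0 ≤ √(n : ℝ) := Real.sqrt_nonneg _
  have hgap : c * √(n : ℝ) ≤ √(m : ℝ) - √(n : ℝ) * Real.sin (α + (β - α - τ)) := by
    have h1 := two_mul_sin_mul_cos_le hτ.le (by linarith : τ ≤ β) hβ.le
    rw [hcβ] at h1
    have h2 := mul_le_mul_of_nonneg_left (hc.trans h1) hq
    rw [hsβ, show α + (β - α - τ) = β - τ by ring]
    linarith
  -- Trading `√(m - 1)` for `√m - 1` turns the loss `3` into `4`. For `m = 0` the root of `-1` is
  -- `0`, which is consistent.
  have hm1 : √(m : ℝ) - 1 ≤ √((m : ℝ) - 1) := by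
    rcases Nat.eq_zero_or_pos m with rfl | hm
    · norm_num
    · have hm' : (1 : ℝ) ≤ m := by exact_mod_cast hm
      have h1 : 1 ≤ √(m : ℝ) := Real.one_le_sqrt.2 hm'
      refine Real.le_sqrt_of_sq_le ?_
      nlinarith [Real.sq_sqrt (zero_le_one.trans hm')]
  have hD : c * √(n : ℝ) - 4 ≤
      √((m : ℝ) - 1) - √(n : ℝ) * Real.sin (α + (β - α - τ)) - 3 := by linarith
  have hmain := hA.measure_minConicSingularValue_ge hTc hT hα (by linarith) (θ := β - α - τ)
    (by linarith) (by linarith) hsα (by linarith)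
  refine le_trans ?_ (hmain.trans (measure_mono fun w hw => hsin.trans hw))
  refine tsub_le_tsub_left (ENNReal.ofReal_le_ofReal ?_) _
  have : 0 < c * √(n : ℝ) - 4 := by linarith
  gcongr

/-- A strictly better point gives a nonzero descent direction, so no supremum or infimum is taken
over the empty set. -/
theorem unitPart_tangentCone_nonempty {n : ℕ} {f : EuclideanSpace ℝ (Fin n) → ℝ}
    {x₀ : EuclideanSpace ℝ (Fin n)} (h : ∃ y, f y < f x₀) :
    (unitPart (tangentCone f x₀)).Nonempty := by
  obtain ⟨y, hy⟩ := h
  have hne : y - x₀ ≠ 0 := by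
    intro h0
    rw [sub_eq_zero.1 h0] at hy
    exact lt_irrefl _ hy
  have hmem : y - x₀ ∈ PointedCone.hull ℝ (descentSet f x₀) :=
    Submodule.subset_span (by simpa [descentSet] using hy.le)
  refine ⟨‖y - x₀‖⁻¹ • (y - x₀), subset_closure ?_, ?_⟩
  · exact (PointedCone.hull ℝ (descentSet f x₀)).smul_mem
      (inv_nonneg.2 (norm_nonneg _)) hmem
  · rw [norm_smul, norm_inv, norm_norm, inv_mul_cancel₀ (norm_ne_zero_iff.2 hne)]

end Asymptotics

theorem theorem2
    -- the sizes of the problem instances, indexed by `k`, in the linear regime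
    (m n : ℕ → ℕ) (hmn : ∀ k, m k ≤ n k) (hn : Tendsto n atTop atTop)
    (δ : ℝ) (hδ0 : 0 < δ) (hδ1 : δ < 1)
    (hδ : Tendsto (fun k => (m k : ℝ) / (n k : ℝ)) atTop (𝓝 δ))
    -- the convex functions and the points
    (f : (k : ℕ) → EuclideanSpace ℝ (Fin (n k)) → ℝ)
    (hf : ∀ k, ConvexOn ℝ Set.univ (f k)) (hfc : ∀ k, Continuous (f k))
    (x₀ : (k : ℕ) → EuclideanSpace ℝ (Fin (n k)))
    (hx₀ : ∀ k, ∃ y, f k y < f k (x₀ k))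
    -- the Gaussian widths of the tangent cones
    (ω : ℕ → ℝ) (hω : ∀ k, ω k = gaussianWidth (tangentCone (f k) (x₀ k)))
    (ε : ℝ) (hε : 0 < ε)
    (hωm : ∀ᶠ k in atTop, ε * (m k : ℝ) < ω k ^ 2 ∧ ω k ^ 2 < (1 - ε) * (m k : ℝ))
    -- the i.r.o. matrices
    (Ω : ℕ → Type*) [∀ k, MeasurableSpace (Ω k)]
    (P : (k : ℕ) → Measure (Ω k)) [∀ k, IsProbabilityMeasure (P k)]
    (A : (k : ℕ) → Ω k → Matrix (Fin (m k)) (Fin (n k)) ℝ)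
    (hA : ∀ k, IsIRO (P k) (A k)) :
    (∀ ζ : ℝ, 0 < ζ →
      Tendsto
        (fun k => P k {w | conicBound (m k) (n k) (ω k) - ζ ≤
          minConicSingularValue (A k w) (tangentCone (f k) (x₀ k))})
        atTop (𝓝 1)) ∧
    (∀ᶠ k in atTop,
      (Real.sqrt (m k) - ω k) / Real.sqrt (n k) < conicBound (m k) (n k) (ω k)) := by
  have hnR : Tendsto (fun k => (n k : ℝ)) atTop atTop := tendsto_natCast_atTop_atTop.comp hn
  have hne : ∀ k, (unitPart (tangentCone (f k) (x₀ k))).Nonempty := fun k =>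
    unitPart_tangentCone_nonempty (hx₀ k)
  have hn0 : ∀ᶠ k in atTop, (0 : ℝ) < n k := hnR.eventually_gt_atTop 0
  have hlt : ∀ᶠ k in atTop, m k < n k := by
    filter_upwards [hn0, hδ.eventually_lt_const hδ1] with k hk hk'
    rw [div_lt_one hk] at hk'
    exact_mod_cast hk'
  have hωlt : ∀ᶠ k in atTop, 0 < ω k ^ 2 ∧ ω k ^ 2 < m k := by
    filter_upwards [hωm] with k hk
    have hm0 : (0 : ℝ) ≤ m k := Nat.cast_nonneg _
    exact ⟨(mul_nonneg hε.le hm0).trans_lt hk.1, by nlinarith [mul_nonneg hε.le hm0, hk.2]⟩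
  have hω0 : ∀ k, 0 ≤ ω k := fun k => by
    rw [hω]
    exact gaussianWidth_nonneg (hne k)
  constructor
  · intro ζ hζ
    -- The cap at `1` keeps `τ / 2` inside `(0, π)`, where the sine is positive.
    set τ := min ζ 1 with hτdef
    have hτ : 0 < τ := lt_min hζ one_pos
    have hsτ : 0 < Real.sin (τ / 2) := Real.sin_pos_of_pos_of_lt_pi (by linarith)
      (by linarith [min_le_right ζ 1, Real.pi_gt_three])
    have hδ' : 0 < √(1 - δ) := Real.sqrt_pos.2 (by linarith)
    -- Half the limit of the available margin, so it is eventually below that margin.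
    set c := Real.sin (τ / 2) * √(1 - δ) with hc
    have hc0 : 0 < c := mul_pos hsτ hδ'
    have hgap : ∀ᶠ k in atTop, c ≤ 2 * Real.sin (τ / 2) * √(1 - (m k : ℝ) / n k) := by
      have hlim : Tendsto (fun k => 2 * Real.sin (τ / 2) * √(1 - (m k : ℝ) / n k)) atTop
          (𝓝 (2 * Real.sin (τ / 2) * √(1 - δ))) :=
        ((tendsto_const_nhds.sub hδ).sqrt).const_mul _
      exact (hlim.eventually_const_lt (by linarith)).mono fun k hk => hk.le
    have hcn : Tendsto (fun k => c * √(n k : ℝ) - 4) atTop atTop :=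
      tendsto_atTop_add_const_right _ _ ((Real.tendsto_sqrt_atTop.comp hnR).const_mul_atTop hc0)
    have hlower : Tendsto (fun k => 1 - ENNReal.ofReal (2 / (c * √(n k : ℝ) - 4) ^ 2)) atTop
        (𝓝 1) := by
      have h1 : Tendsto (fun k => 2 / (c * √(n k : ℝ) - 4) ^ 2) atTop (𝓝 0) :=
        ((tendsto_pow_atTop two_ne_zero).comp hcn).const_div_atTop 2
      have h2 := ENNReal.Tendsto.sub (tendsto_const_nhds (x := (1 : ENNReal)))
        (ENNReal.tendsto_ofReal h1) (Or.inl ENNReal.one_ne_top)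
      simpa using h2
    refine tendsto_of_tendsto_of_tendsto_of_le_of_le' hlower tendsto_const_nhds ?_
      (Eventually.of_forall fun k => prob_le_one)
    filter_upwards [hlt, hωlt, hgap, hcn.eventually_gt_atTop 0] with k hk1 hk2 hk3 hk4
    have hk5 := hk2.2
    rw [hω k] at hk5 ⊢
    exact (hA k).measure_conicBound_sub_le isClosed_closure (hne k) hk1 hk5 hτ (min_le_left _ _)
      hk3 (by linarith)
  · filter_upwards [hlt, hωlt, hn0] with k hk1 hk2 hk3
    obtain ⟨α, β, hα, hαβ, hβ, hsα, hsβ, -⟩ := exists_angles hk1 (hω0 k) hk2.2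
    have hq : 0 < √(n k : ℝ) := Real.sqrt_pos.2 hk3
    rw [conicBound_eq_sin hk1 hk2.2 ⟨hα, by linarith⟩ ⟨by linarith, hβ.le⟩ hsα hsβ]
    -- Strictness needs `ω ≠ 0`, which comes from the lower bound `ε m < ω²`.
    have hα0 : 0 < α := by
      refine lt_of_le_of_ne hα fun h => ?_
      rw [← h, Real.sin_zero, mul_zero] at hsα
      rw [hsα] at hk2
      norm_num at hk2
    have h1 : (√(m k : ℝ) - ω k) / √(n k : ℝ) = Real.sin β - Real.sin α := by
      rw [hsα, hsβ]
      field_simp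
    rw [h1]
    exact sin_sub_sin_lt_sin_sub hα0 hαβ (by linarith [Real.pi_pos])
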